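/- **Theorem 6.3 (Gauss–Lobatto cubature).** Let $$\triangle^*=\{(x,y)\in\mathbb R^2:\ 1+2y-3x^2\ge 0\ \text{ and }\ 24x^3-y^2-12xy-6x-4y-1\ge 0\},$$ a compact region bounded by the curves $1+2y-3x^2=0$ and $24x^3-y^2-12xy-6x-4y-1=0$. On $\triangle^*$ let $$w_{\alpha,\beta}(x,y)=\frac{(4\pi^2)^{\alpha+\beta}}{3^{2\alpha+\beta}}\,(1+2y-3x^2)^{\alpha}\,(24x^3-y^2-12xy-6x-4y-1)^{\beta},\qquad c_{\alpha,\beta}=\Big(\iint_{\triangle^*}w_{\alpha,\beta}(x,y)\,dx\,dy\Big)^{-1}.$$ For $\mathbf t=(t_1,t_2,t_3)\in\mathbb R^3$ with $t_1+t_2+t_3=0$ put $$x(\mathbf t)=\tfrac13\Big(\cos\tfrac{2\pi(t_1-t_2)}{3}+\cos\tfrac{2\pi(t_2-t_3)}{3}+\cos\tfrac{2\pi(t_3-t_1)}{3}\Big),\qquad y(\mathbf t)=\tfrac13\big(\cos 2\pi t_1+\cos 2\pi t_2+\cos 2\pi t_3\big).$$ For an integer $n\ge 1$ let $$\Upsilon_n=\{\mathbf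 j\in\mathbb Z^3:\ j_1+j_2+j_3=0,\ j_1\equiv j_2\equiv j_3\!\!\pmod 3,\ 0\le j_2\le j_1\le -j_3\le n\},$$ and for $\mathbf j\in\Upsilon_n$ let $\omega^{(n)}_{\mathbf j}=12$ if $0<j_2<j_1<-j_3<n$, $\omega^{(n)}_{\mathbf j}=1$ if $\mathbf j=(0,0,0)$, $\omega^{(n)}_{\mathbf j}=2$ if $\mathbf j=(n,0,-n)$, $\omega^{(n)}_{\mathbf j}=3$ if $\mathbf j=(\tfrac n2,\tfrac n2,-n)$, and $\omega^{(n)}_{\mathbf j}=6$ otherwise. For $d\ge 0$ let $\Pi_d^*=\operatorname{span}\{x^{k_1}y^{k_2}:\ k_1,k_2\ge 0,\ 2k_1+3k_2\le d\}$ (with real or complex coefficients). Then for every $n\ge 1$ and every $f\in\Pi^*_{2n-1}$ the function $f\,w_{-\frac12,-\frac12}$ is integrable on $\triangle^*$ and $$c_{-\frac12,-\frac12}\iint_{\triangle^*} f(x,y)\,w_{-\frac12,-\frac12}(x,y)\,dx\,dy=\frac1{n^2}\sum_{\mathbf j\in\Upsilon_n}\omega^{(n)}_{\mathbf j}\,f\big(x(\tfrac{\mathbf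 j}{n}),y(\tfrac{\mathbf j}{n})\big).$$ -/

import Mathlib

open MeasureTheory

noncomputable section

namespace GaussLobattoG2

/-- The polynomials in two variables of `m`-degree at most `d`: the linear span of the monomials
`x ^ k₁ * y ^ k₂` with `2 * k₁ + 3 * k₂ ≤ d`. -/
def PiStar (𝕜 : Type*) [Field 𝕜] (d : ℕ) : Submodule 𝕜 (MvPolynomial (Fin 2) 𝕜) :=
  Submodule.span 𝕜
    {p | ∃ k₁ k₂ : ℕ, 2 * k₁ + 3 * k₂ ≤ d ∧ p = MvPolynomial.X 0 ^ k₁ * MvPolynomial.X 1 ^ k₂}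

/-- The first boundary polynomial `1 + 2y - 3x²`. -/
def bdry₁ (p : ℝ × ℝ) : ℝ := 1 + 2 * p.2 - 3 * p.1 ^ 2

/-- The second boundary polynomial `24x³ - y² - 12xy - 6x - 4y - 1`. -/
def bdry₂ (p : ℝ × ℝ) : ℝ :=
  24 * p.1 ^ 3 - p.2 ^ 2 - 12 * p.1 * p.2 - 6 * p.1 - 4 * p.2 - 1

/-- The compact region `△*` of the plane bounded by the two curves `bdry₁ = 0` and `bdry₂ = 0`. -/
def triangleStar : Set (ℝ × ℝ) := {p | 0 ≤ bdry₁ p ∧ 0 ≤ bdry₂ p}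

/-- The weight `w_{α,β}` (used on `△*`, where both bases are nonnegative). -/
def weight (α β : ℝ) (p : ℝ × ℝ) : ℝ :=
  (4 * Real.pi ^ 2) ^ (α + β) / (3 : ℝ) ^ (2 * α + β) * bdry₁ p ^ α * bdry₂ p ^ β

/-- The normalization constant `c_{α,β} = 1 / ∫_{△*} w_{α,β} dx dy`. -/
def normConst (α β : ℝ) : ℝ := 1 / ∫ p in triangleStar, weight α β p

/-- The generalized cosine `x = CC_{1,0,-1}` of a point `t = (t₁, t₂, t₃)` in homogeneous
coordinates (`t₁ + t₂ + t₃ = 0`). -/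
def xCoord (t : Fin 3 → ℝ) : ℝ :=
  (Real.cos (2 * Real.pi * (t 0 - t 1) / 3) + Real.cos (2 * Real.pi * (t 1 - t 2) / 3)
    + Real.cos (2 * Real.pi * (t 2 - t 0) / 3)) / 3

/-- The generalized cosine `y = CC_{1,1,-2}` of a point `t = (t₁, t₂, t₃)` in homogeneous
coordinates (`t₁ + t₂ + t₃ = 0`). -/
def yCoord (t : Fin 3 → ℝ) : ℝ :=
  (Real.cos (2 * Real.pi * t 0) + Real.cos (2 * Real.pi * t 1)
    + Real.cos (2 * Real.pi * t 2)) / 3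

/-- The index set `Υ_n`: integer triples `j = (j₁, j₂, j₃)` with `j₁ + j₂ + j₃ = 0`,
`j₁ ≡ j₂ ≡ j₃ (mod 3)` and `0 ≤ j₂ ≤ j₁ ≤ -j₃ ≤ n`. The box `[-n, n]³` contains all of them. -/
def Upsilon (n : ℕ) : Finset (Fin 3 → ℤ) :=
  (Fintype.piFinset fun _ : Fin 3 => Finset.Icc (-(n : ℤ)) n).filter fun j =>
    j 0 + j 1 + j 2 = 0 ∧ j 0 ≡ j 1 [ZMOD 3] ∧ j 1 ≡ j 2 [ZMOD 3] ∧
      0 ≤ j 1 ∧ j 1 ≤ j 0 ∧ j 0 ≤ -j 2 ∧ -j 2 ≤ (n : ℤ)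

/-- The weights `ω_j^{(n)}`, for `j ∈ Υ_n` and `n ≥ 1`. -/
def omega (n : ℕ) (j : Fin 3 → ℤ) : ℕ :=
  -- interior points
  if 0 < j 1 ∧ j 1 < j 0 ∧ j 0 < -j 2 ∧ -j 2 < (n : ℤ) then 12
  -- the vertex `0`
  else if j 0 = 0 ∧ j 1 = 0 ∧ j 2 = 0 then 1
  -- the vertex `(n, 0, -n)`
  else if j 0 = n ∧ j 1 = 0 ∧ j 2 = -n then 2
  -- the vertex `(n/2, n/2, -n)`
  else if 2 * j 0 = n ∧ 2 * j 1 = n ∧ j 2 = -n then 3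
  -- the remaining boundary points
  else 6

/-- The value at a real point `(x, y)` of a polynomial with coefficients in `ℝ` or `ℂ`. -/
def evalAt {𝕜 : Type*} [RCLike 𝕜] (f : MvPolynomial (Fin 2) 𝕜) (x y : ℝ) : 𝕜 :=
  MvPolynomial.eval ![(x : 𝕜), (y : 𝕜)] f

end GaussLobattoG2

end

namespace GaussLobattoG2

open Real Set

/-! In the coordinates `u = (t₁ - t₂) / 3`, `v = (t₂ - t₃) / 3` the pair `(x, y)` becomes `cosMap`,
a trigonometric map that is periodic and invariant under a group of order 12 acting on the torus. It
maps the fundamental triangle bijectively onto the region. The Jacobian is, up to constants, a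
product `A * B` for which the boundary polynomials pull back to multiples of `A ^ 2` and `B ^ 2`.
Hence the weight with both exponents `-1/2` pulls back to Lebesgue measure times a constant
(`integral_triangleStar`), and the constant is removed by the normalization.

By symmetry the integral over the triangle is one twelfth of that over the unit square
(`integral_unitSquare_eq`). There a monomial of degree at most `2 * n - 1` becomes a trigonometric
polynomial with frequencies in a hexagon whose only point in `nℤ²` is the origin, so the mean over
the `n × n` grid is exact (`integral_eq_sum_of_mem_trigSpace`).

Folding the grid sum back by the same symmetries gives the sum over `Upsilon`; the weights `omega`
count the grid points in each orbit (`sum_square_eq_sum_Upsilon`). -/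

/-- The closed fundamental triangle. -/
def fundTriangle : Set (ℝ × ℝ) := {z | 0 ≤ z.1 ∧ z.1 ≤ z.2 ∧ z.1 + 2 * z.2 ≤ 1}

/-- The pair of generalized cosines, in the coordinates `u = (t₁ - t₂) / 3`, `v = (t₂ - t₃) / 3`. -/
noncomputable def cosMap (z : ℝ × ℝ) : ℝ × ℝ :=
  ((cos (2 * π * z.1) + cos (2 * π * z.2) + cos (2 * π * (z.1 + z.2))) / 3,
    (cos (2 * π * (2 * z.1 + z.2)) + cos (2 * π * (z.2 - z.1))
      + cos (2 * π * (z.1 + 2 * z.2))) / 3)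

/-- The generalized cosines as polynomials in two ordinary cosines. -/
noncomputable def polyMap (c d : ℝ) : ℝ × ℝ :=
  ((2 * c * d + 2 * c ^ 2 - 1) / 3, (2 * (4 * c ^ 3 - 3 * c) * d + 2 * d ^ 2 - 1) / 3)

/-! ### Factorization of the boundary polynomials -/

theorem cosMap_eq_polyMap (z : ℝ × ℝ) :
    cosMap z = polyMap (cos (π * (z.1 + z.2))) (cos (π * (z.2 - z.1))) := by
  obtain ⟨u, v⟩ := z
  set p := π * (u + v) with hp
  set q := π * (v - u) with hq
  have e1 : 2 * π * u = p - q := by rw [hp, hq]; ring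
  have e2 : 2 * π * v = p + q := by rw [hp, hq]; ring
  have e3 : 2 * π * (u + v) = 2 * p := by rw [hp]; ring
  have e4 : 2 * π * (2 * u + v) = 3 * p - q := by rw [hp, hq]; ring
  have e5 : 2 * π * (v - u) = 2 * q := by rw [hq]; ring
  have e6 : 2 * π * (u + 2 * v) = 3 * p + q := by rw [hp, hq]; ring
  simp only [cosMap, polyMap]
  rw [e1, e2, e3, e4, e5, e6, cos_sub, cos_add, cos_sub, cos_add, cos_two_mul, cos_two_mul,
    cos_three_mul]
  simp only [Prod.mk.injEq]
  constructor <;> ring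

theorem bdry₁_polyMap (c d : ℝ) :
    bdry₁ (polyMap c d) = 4 / 3 * (1 - c ^ 2) * (d - c) ^ 2 := by
  simp only [bdry₁, polyMap]; ring

theorem bdry₂_polyMap (c d : ℝ) :
    bdry₂ (polyMap c d) = 4 / 9 * (1 - d ^ 2) * (d - 4 * c ^ 3 + 3 * c) ^ 2 := by
  simp only [bdry₂, polyMap]; ring

theorem bdry₁_cosMap (z : ℝ × ℝ) : bdry₁ (cosMap z) = 4 / 3 *
    (sin (π * (z.1 + z.2)) * (cos (π * (z.2 - z.1)) - cos (π * (z.1 + z.2)))) ^ 2 := by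
  rw [cosMap_eq_polyMap, bdry₁_polyMap, mul_pow, sin_sq]; ring

theorem bdry₂_cosMap (z : ℝ × ℝ) : bdry₂ (cosMap z) = 4 / 9 *
    (sin (π * (z.2 - z.1)) * (cos (π * (z.2 - z.1)) - 4 * cos (π * (z.1 + z.2)) ^ 3
      + 3 * cos (π * (z.1 + z.2)))) ^ 2 := by
  rw [cosMap_eq_polyMap, bdry₂_polyMap, mul_pow, sin_sq]; ring

theorem cosMap_mem_triangleStar (z : ℝ × ℝ) : cosMap z ∈ triangleStar := by
  refine ⟨?_, ?_⟩
  · rw [bdry₁_cosMap]; positivity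
  · rw [bdry₂_cosMap]; positivity

/-! ### Injectivity -/

/-- Equal elementary symmetric functions mean equal monic cubics, so each largest root is a root of
the other cubic; comparing them gives `a = a'`, and the remaining pair is treated alike. -/
theorem sorted_triple_unique {a b c a' b' c' : ℝ} (h1 : b ≤ a) (h2 : c ≤ b) (h1' : b' ≤ a')
    (h2' : c' ≤ b') (e1 : a + b + c = a' + b' + c')
    (e2 : a * b + a * c + b * c = a' * b' + a' * c' + b' * c')
    (e3 : a * b * c = a' * b' * c') : a = a' ∧ b = b' := by
  have ha : (a - a') * (a - b') * (a - c') = 0 := by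
    linear_combination (-a ^ 2) * (-e1) + a * (-e2) - (-e3)
  have ha' : (a' - a) * (a' - b) * (a' - c) = 0 := by
    linear_combination (-a' ^ 2) * e1 + a' * e2 - e3
  have haa : a = a' := by
    have l1 : a ≤ a' := by
      rcases mul_eq_zero.1 ha with h | h
      · rcases mul_eq_zero.1 h with h | h <;> linarith
      · linarith
    have l2 : a' ≤ a := by
      rcases mul_eq_zero.1 ha' with h | h
      · rcases mul_eq_zero.1 h with h | h <;> linarith
      · linarith
    linarith
  subst haa
  refine ⟨rfl, ?_⟩
  have e2' : b * c = b' * c' := by linear_combination e2 - a * e1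
  have hb : (b - b') * (b - c') = 0 := by linear_combination b * e1 - e2'
  have hb' : (b' - b) * (b' - c) = 0 := by linear_combination (-b') * e1 + e2'
  rcases mul_eq_zero.1 hb with h | h <;> rcases mul_eq_zero.1 hb' with h' | h' <;> linarith

/-- The elementary symmetric functions of the cosines of `2πu`, `2πv`, `2π(u + v)` are polynomials
in `x` and `y`. On the triangle these cosines are in decreasing order, so they are recovered
individually, and the first two angles lie in `[0, π]`, where cosine is injective. -/
theorem injOn_cosMap : InjOn cosMap fundTriangle := by
  have key : ∀ z ∈ fundTriangle, cos (2 * π * z.2) ≤ cos (2 * π * z.1) ∧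
      cos (2 * π * (z.1 + z.2)) ≤ cos (2 * π * z.2) ∧ 2 * π * z.1 ∈ Icc 0 π ∧
      2 * π * z.2 ∈ Icc 0 π := by
    rintro ⟨u, v⟩ ⟨h1, h2, h3⟩
    dsimp only at *
    have hπ := pi_pos
    have hv : 2 * π * v ≤ π := by nlinarith
    refine ⟨cos_le_cos_of_nonneg_of_le_pi (by positivity) hv (by nlinarith), ?_,
      ⟨by positivity, by nlinarith⟩, ⟨by nlinarith, hv⟩⟩
    -- Monotonicity of cosine is unavailable, since `2π(u + v)` may exceed `π`.
    have e := cos_sub_cos (2 * π * v) (2 * π * (u + v))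
    have e1 : (2 * π * v + 2 * π * (u + v)) / 2 = π * (u + 2 * v) := by ring
    have e2 : (2 * π * v - 2 * π * (u + v)) / 2 = -(π * u) := by ring
    rw [e1, e2, sin_neg] at e
    have s1 : 0 ≤ sin (π * (u + 2 * v)) :=
      sin_nonneg_of_nonneg_of_le_pi (by nlinarith) (by nlinarith)
    have s2 : 0 ≤ sin (π * u) := sin_nonneg_of_nonneg_of_le_pi (by nlinarith) (by nlinarith)
    nlinarith [mul_nonneg s1 s2]
  have symm : ∀ z : ℝ × ℝ,
      cos (2 * π * z.1) + cos (2 * π * z.2) + cos (2 * π * (z.1 + z.2)) = 3 * (cosMap z).1 ∧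
      cos (2 * π * z.1) * cos (2 * π * z.2) + cos (2 * π * z.1) * cos (2 * π * (z.1 + z.2))
        + cos (2 * π * z.2) * cos (2 * π * (z.1 + z.2))
        = (3 * (cosMap z).1 + 3 * (cosMap z).2) / 2 ∧
      cos (2 * π * z.1) * cos (2 * π * z.2) * cos (2 * π * (z.1 + z.2)) =
        ((3 * (cosMap z).1) ^ 2 - (3 * (cosMap z).1 + 3 * (cosMap z).2) - 1) / 2 := by
    rintro ⟨u, v⟩
    simp only [cosMap]
    set p := 2 * π * u with hp
    set q := 2 * π * v with hq
    have f1 : 2 * π * (u + v) = p + q := by rw [hp, hq]; ring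
    have f2 : 2 * π * (2 * u + v) = p + (p + q) := by rw [hp, hq]; ring
    have f3 : 2 * π * (v - u) = q - p := by rw [hp, hq]; ring
    have f4 : 2 * π * (u + 2 * v) = q + (p + q) := by rw [hp, hq]; ring
    rw [f1, f2, f3, f4]
    have g1 : 2 * cos p * cos (p + q) = cos q + cos (p + (p + q)) := by
      have := two_mul_cos_mul_cos p (p + q)
      rw [this, show p - (p + q) = -q by ring, cos_neg]
    have g2 : 2 * cos q * cos (p + q) = cos p + cos (q + (p + q)) := by
      have := two_mul_cos_mul_cos q (p + q)
      rw [this, show q - (p + q) = -p by ring, cos_neg]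
    have g3 : 2 * cos p * cos q = cos (q - p) + cos (p + q) := by
      have := two_mul_cos_mul_cos p q
      rw [this, show p - q = -(q - p) by ring, cos_neg]
    have g4 : cos p ^ 2 + cos q ^ 2 + cos (p + q) ^ 2 - 1
        = 2 * (cos p * cos q * cos (p + q)) := by
      rw [cos_add]
      linear_combination (sin q ^ 2) * sin_sq_add_cos_sq p + (1 - cos p ^ 2) * sin_sq_add_cos_sq q
    refine ⟨by ring, by linear_combination g1 / 2 + g2 / 2 + g3 / 2, ?_⟩
    linear_combination - g4 / 2 - g1 / 2 - g2 / 2 - g3 / 2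
  intro z hz z' hz' h
  obtain ⟨a1, a2, a3, a4⟩ := key z hz
  obtain ⟨b1, b2, b3, b4⟩ := key z' hz'
  obtain ⟨c1, c2, c3⟩ := symm z
  obtain ⟨d1, d2, d3⟩ := symm z'
  rw [h] at c1 c2 c3
  obtain ⟨r1, r2⟩ := sorted_triple_unique a1 a2 b1 b2 (c1.trans d1.symm) (c2.trans d2.symm)
    (c3.trans d3.symm)
  have k1 := injOn_cos a3 b3 r1
  have k2 := injOn_cos a4 b4 r2
  have h2π : (2 * π) ≠ 0 := by positivity
  exact Prod.ext (mul_left_cancel₀ h2π k1) (mul_left_cancel₀ h2π k2)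

/-! ### The derivative -/

/-- The derivative of `cosMap`. -/
noncomputable def fderivCosMap (z : ℝ × ℝ) : ℝ × ℝ →L[ℝ] ℝ × ℝ :=
  LinearMap.toContinuousLinearMap (Matrix.toLin (Module.Basis.finTwoProd ℝ)
    (Module.Basis.finTwoProd ℝ)
    (let c := cos (π * (z.1 + z.2))
     let d := cos (π * (z.2 - z.1))
     let s := π * sin (π * (z.1 + z.2))
     let t := π * sin (π * (z.2 - z.1))
     !![(-(2 * d + 4 * c) * s + 2 * c * t) / 3, (-(2 * d + 4 * c) * s - 2 * c * t) / 3;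
      (-((24 * c ^ 2 - 6) * d) * s + (8 * c ^ 3 - 6 * c + 4 * d) * t) / 3,
      (-((24 * c ^ 2 - 6) * d) * s - (8 * c ^ 3 - 6 * c + 4 * d) * t) / 3]))

theorem hasFDerivAt_cosMap (z : ℝ × ℝ) : HasFDerivAt cosMap (fderivCosMap z) z := by
  have hc : HasFDerivAt (fun w : ℝ × ℝ => cos (π * (w.1 + w.2)))
      (-sin (π * (z.1 + z.2)) • π • (ContinuousLinearMap.fst ℝ ℝ ℝ +
        ContinuousLinearMap.snd ℝ ℝ ℝ)) z :=
    ((hasFDerivAt_fst.add hasFDerivAt_snd).const_mul π).cos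
  have hd : HasFDerivAt (fun w : ℝ × ℝ => cos (π * (w.2 - w.1)))
      (-sin (π * (z.2 - z.1)) • π • (ContinuousLinearMap.snd ℝ ℝ ℝ -
        ContinuousLinearMap.fst ℝ ℝ ℝ)) z :=
    ((hasFDerivAt_snd.sub hasFDerivAt_fst).const_mul π).cos
  have h1 := ((((hc.const_mul 2).mul hd).add ((hc.pow 2).const_mul 2)).sub_const 1).mul_const
    (3 : ℝ)⁻¹
  have h2 := ((((((hc.pow 3).const_mul 4).sub (hc.const_mul 3)).const_mul 2).mul hd).add
    ((hd.pow 2).const_mul 2)).sub_const 1 |>.mul_const (3 : ℝ)⁻¹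
  have h := h1.prodMk h2
  have e : cosMap = fun w => polyMap (cos (π * (w.1 + w.2))) (cos (π * (w.2 - w.1))) :=
    funext cosMap_eq_polyMap
  rw [e]
  refine HasFDerivAt.congr_fderiv (f' := _) h ?_
  rw [fderivCosMap, Matrix.toLin_finTwoProd_toContinuousLinearMap]
  ext <;> simp <;> ring

/-- The two factors are exactly those squared in `bdry₁_cosMap` and `bdry₂_cosMap`; this is what
cancels the weight. -/
theorem det_fderivCosMap (z : ℝ × ℝ) : (fderivCosMap z).det = 16 * π ^ 2 / 9 *
    (sin (π * (z.1 + z.2)) * (cos (π * (z.2 - z.1)) - cos (π * (z.1 + z.2)))) *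
    (sin (π * (z.2 - z.1)) * (cos (π * (z.2 - z.1)) - 4 * cos (π * (z.1 + z.2)) ^ 3
      + 3 * cos (π * (z.1 + z.2)))) := by
  conv_lhs => rw [fderivCosMap, ContinuousLinearMap.det, LinearMap.coe_toContinuousLinearMap,
    LinearMap.det_toLin, Matrix.det_fin_two_of]
  ring

/-! ### Surjectivity onto the region -/

/-- Fix `x` by `s ^ 2 = 6x + 3` and take `c` to be the larger root of `c ^ 2 + c * d = (s ^ 2 - 1) /
4`. The second coordinate is then continuous in `d`, and `d = 1` gives the upper branch of `bdry₂ =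
0`, so the intermediate value theorem applies. -/
theorem exists_polyMap_eq_of_le {s y d₀ : ℝ} (hs : 0 ≤ s) (hd₀ : d₀ ≤ 1)
    (hd : ∀ d ∈ Icc d₀ 1, 0 ≤ d ^ 2 + s ^ 2 - 1)
    (hlow : (polyMap ((-d₀ + √(d₀ ^ 2 + s ^ 2 - 1)) / 2) d₀).2 ≤ y)
    (hup : y ≤ 1 - s ^ 2 + s ^ 3 / 3) :
    ∃ d ∈ Icc d₀ 1, polyMap ((-d + √(d ^ 2 + s ^ 2 - 1)) / 2) d = ((s ^ 2 - 3) / 6, y) := by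
  have hcont : Continuous fun d : ℝ => (polyMap ((-d + √(d ^ 2 + s ^ 2 - 1)) / 2) d).2 := by
    unfold polyMap; fun_prop
  have h1 : (polyMap ((-1 + √(1 ^ 2 + s ^ 2 - 1)) / 2) 1).2 = 1 - s ^ 2 + s ^ 3 / 3 := by
    rw [show (1 : ℝ) ^ 2 + s ^ 2 - 1 = s ^ 2 by ring, sqrt_sq hs]
    simp only [polyMap]; ring
  obtain ⟨d, hdm, hdy⟩ := intermediate_value_Icc hd₀ hcont.continuousOn
    ⟨hlow, (hup.trans_eq h1.symm)⟩
  refine ⟨d, hdm, Prod.ext ?_ hdy⟩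
  simp only [polyMap]
  have := sq_sqrt (hd d hdm)
  linear_combination this / 6

theorem exists_polyMap_eq_of_one_le {s y : ℝ} (h1s : 1 ≤ s) (hs3 : s ≤ 3)
    (h1 : 0 ≤ 1 + 2 * y - 3 * ((s ^ 2 - 3) / 6) ^ 2) (hup : y ≤ 1 - s ^ 2 + s ^ 3 / 3) :
    ∃ c d : ℝ, polyMap c d = ((s ^ 2 - 3) / 6, y) ∧
      -(1 / 2) ≤ c ∧ c ≤ d ∧ d ≤ 1 ∧ 4 * c ^ 3 - 3 * c ≤ d := by
  have hs : 0 ≤ s := by linarith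
  -- At this `d₀` the root is `c = d₀`, so the path starts on the curve `bdry₁ = 0`.
  obtain ⟨d₀, hd₀, hd₀s⟩ : ∃ d₀, 0 ≤ d₀ ∧ d₀ ^ 2 = (s ^ 2 - 1) / 8 :=
    ⟨√((s ^ 2 - 1) / 8), sqrt_nonneg _, sq_sqrt (by nlinarith)⟩
  have hr : √(d₀ ^ 2 + s ^ 2 - 1) = 3 * d₀ := by
    rw [show d₀ ^ 2 + s ^ 2 - 1 = (3 * d₀) ^ 2 by linarith, sqrt_sq (by linarith)]
  have hd₀1 : d₀ ≤ 1 := by nlinarith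
  obtain ⟨d, ⟨hd, hd1⟩, he⟩ := exists_polyMap_eq_of_le (y := y) hs hd₀1
    (fun d hd => by nlinarith [sq_nonneg d]) (by
      rw [hr, show (-d₀ + 3 * d₀) / 2 = d₀ by ring]
      simp only [polyMap]
      have : d₀ ^ 4 = ((s ^ 2 - 1) / 8) ^ 2 := by rw [← hd₀s]; ring
      nlinarith) (by linarith)
  have hrd : 0 ≤ √(d ^ 2 + s ^ 2 - 1) := sqrt_nonneg _
  have hc0 : d ≤ √(d ^ 2 + s ^ 2 - 1) := le_sqrt_of_sq_le (by nlinarith)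
  have hcd : √(d ^ 2 + s ^ 2 - 1) ≤ 3 * d := by
    rw [sqrt_le_left (by linarith)]; nlinarith
  refine ⟨_, d, he, by linarith, by linarith, hd1, ?_⟩
  set c := (-d + √(d ^ 2 + s ^ 2 - 1)) / 2
  have k0 : 0 ≤ c := by simp only [c]; linarith
  have k1 : c ≤ d := by simp only [c]; linarith
  have k2 : 0 ≤ 1 - c ^ 2 := sub_nonneg.2 (pow_le_one₀ k0 (k1.trans hd1))
  have k3 : c * (1 - c ^ 2) = c - c ^ 3 := by ring
  linarith [mul_nonneg k0 k2]

theorem exists_polyMap_eq_of_lt_one {s y : ℝ} (hs : 0 ≤ s) (h1s : s < 1)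
    (hlow : 1 - s ^ 2 - s ^ 3 / 3 ≤ y) (hup : y ≤ 1 - s ^ 2 + s ^ 3 / 3) :
    ∃ c d : ℝ, polyMap c d = ((s ^ 2 - 3) / 6, y) ∧
      -(1 / 2) ≤ c ∧ c ≤ d ∧ d ≤ 1 ∧ 4 * c ^ 3 - 3 * c ≤ d := by
  -- The path starts at `c = -r/2`, `d = 4c³ - 3c = (3 - r²)r/2`, on the lower branch of `bdry₂ =
  -- 0`.
  obtain ⟨r, hr0, hrs⟩ : ∃ r, 0 ≤ r ∧ r ^ 2 = 1 - s :=
    ⟨√(1 - s), sqrt_nonneg _, sq_sqrt (by linarith)⟩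
  obtain rfl : s = 1 - r ^ 2 := by linarith
  have hr1 : r ≤ 1 := by nlinarith
  have hd₀ : 0 ≤ (3 - r ^ 2) * r / 2 := by
    have : 0 ≤ 3 - r ^ 2 := by linarith
    positivity
  have hd₀1 : (3 - r ^ 2) * r / 2 ≤ 1 := by
    nlinarith [mul_nonneg (sq_nonneg (r - 1)) (by linarith : 0 ≤ r + 2)]
  have hd₀s : ((3 - r ^ 2) * r / 2) ^ 2 + (1 - r ^ 2) ^ 2 - 1 = (r * (1 - r ^ 2) / 2) ^ 2 := by
    ring
  have hr : √(((3 - r ^ 2) * r / 2) ^ 2 + (1 - r ^ 2) ^ 2 - 1) = r * (1 - r ^ 2) / 2 := by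
    rw [hd₀s, sqrt_sq (by positivity)]
  have hmono : ∀ d ∈ Icc ((3 - r ^ 2) * r / 2) 1, ((3 - r ^ 2) * r / 2) ^ 2 ≤ d ^ 2 :=
    fun d hd => pow_le_pow_left₀ hd₀ hd.1 2
  have hnn := sq_nonneg (r * (1 - r ^ 2) / 2)
  obtain ⟨d, hd, he⟩ := exists_polyMap_eq_of_le (y := y) hs hd₀1
    (fun d hd => by linarith [hmono d hd]) (by
      rw [hr]
      simp only [polyMap]
      nlinarith) (by linarith)
  have hdd := hmono d hd
  obtain ⟨hd, hd1⟩ := hd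
  have hc0 : √(d ^ 2 + (1 - r ^ 2) ^ 2 - 1) ≤ d := by
    rw [sqrt_le_left (by linarith)]; nlinarith
  have hcr : d - r ≤ √(d ^ 2 + (1 - r ^ 2) ^ 2 - 1) := by
    apply le_sqrt_of_sq_le
    nlinarith [mul_nonneg hr0 (sub_nonneg.2 hd)]
  refine ⟨_, d, he, by linarith, by linarith, hd1, ?_⟩
  set c := (-d + √(d ^ 2 + (1 - r ^ 2) ^ 2 - 1)) / 2
  have k0 : 0 ≤ -c := by simp only [c]; linarith
  have k1 : -c ≤ r / 2 := by simp only [c]; linarith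
  clear_value c
  -- This is the increment of `t ↦ 3t - 4t³`, increasing on `[0, 1/2]`, from `-c` to `r/2`.
  have k2 : 0 ≤ (r / 2 + c) * (3 - 4 * ((r / 2) ^ 2 + (r / 2) * (-c) + c ^ 2)) := by
    apply mul_nonneg (by linarith)
    have : (-c) ^ 2 ≤ (r / 2) ^ 2 := pow_le_pow_left₀ k0 k1 2
    nlinarith [mul_le_mul k1 (by linarith : r / 2 ≤ r / 2) (by linarith) (by linarith)]
  nlinarith

theorem exists_polyMap_eq {p : ℝ × ℝ} (hp : p ∈ triangleStar) :
    ∃ c d : ℝ, polyMap c d = p ∧ -(1 / 2) ≤ c ∧ c ≤ d ∧ d ≤ 1 ∧ 4 * c ^ 3 - 3 * c ≤ d := by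
  obtain ⟨x, y⟩ := p
  obtain ⟨h1, h2⟩ := hp
  simp only [bdry₁, bdry₂] at h1 h2
  -- The second boundary polynomial equals `3(2x + 1)³ - (y + 6x + 2)²`.
  have hx : 0 ≤ 6 * x + 3 := by
    by_contra! h
    have : (2 * x + 1) ^ 3 < 0 := Odd.pow_neg (by decide) (by linarith)
    nlinarith [sq_nonneg (y + 6 * x + 2)]
  obtain ⟨s, hs, hsx⟩ : ∃ s, 0 ≤ s ∧ s ^ 2 = 6 * x + 3 := ⟨√(6 * x + 3), sqrt_nonneg _, sq_sqrt hx⟩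
  obtain rfl : x = (s ^ 2 - 3) / 6 := by linarith
  have hsq : (y + s ^ 2 - 1) ^ 2 ≤ (s ^ 3 / 3) ^ 2 := by nlinarith
  obtain ⟨hlow, hup⟩ := abs_le_of_sq_le_sq' hsq (by positivity)
  -- Inserting the upper bound on `y` into `bdry₁ ≥ 0` gives `(s - 3)³(s + 1) ≤ 0`.
  have hs3 : s ≤ 3 := by
    by_contra! h
    have : 0 < (s - 3) ^ 3 * (s + 1) := mul_pos (pow_pos (by linarith) 3) (by linarith)
    nlinarith
  rcases le_or_gt 1 s with h1s | h1s
  · exact exists_polyMap_eq_of_one_le h1s hs3 (by linarith) (by linarith)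
  · exact exists_polyMap_eq_of_lt_one hs h1s (by linarith) (by linarith)

theorem image_cosMap_fundTriangle : cosMap '' fundTriangle = triangleStar := by
  apply Subset.antisymm
  · rintro _ ⟨z, -, rfl⟩
    exact cosMap_mem_triangleStar z
  intro p hp
  obtain ⟨c, d, rfl, hc, hcd, hd, hcd'⟩ := exists_polyMap_eq hp
  have hπ := pi_pos
  have ec : cos (arccos c) = c := cos_arccos (by linarith) (by linarith)
  have ed : cos (arccos d) = d := cos_arccos (by linarith) hd
  have hqp : arccos d ≤ arccos c := arccos_le_arccos hcd
  have hp3 : arccos c ≤ 2 * π / 3 := by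
    have h := arccos_le_arccos hc
    rwa [arccos_neg, one_div, ← one_div, ← cos_pi_div_three,
      arccos_cos (by positivity) (by linarith), show π - π / 3 = 2 * π / 3 by ring] at h
  have hq0 := arccos_nonneg d
  have hsum : 3 * arccos c + arccos d ≤ 2 * π := by
    -- Beyond `π/3`, the angle `2π - 3 arccos c` lies in `[0, π]` and has cosine `4c³ - 3c ≤ d`.
    rcases le_or_gt (arccos c) (π / 3) with h | h
    · linarith
    · have e : cos (2 * π - 3 * arccos c) = 4 * c ^ 3 - 3 * c := by
        rw [cos_two_pi_sub, cos_three_mul, ec]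
      have := arccos_le_arccos hcd'
      rw [← e, arccos_cos (by linarith) (by linarith)] at this
      linarith
  refine ⟨((arccos c - arccos d) / (2 * π), (arccos c + arccos d) / (2 * π)), ⟨?_, ?_, ?_⟩, ?_⟩
  · exact div_nonneg (by linarith) (by positivity)
  · exact div_le_div_of_nonneg_right (by linarith) (by positivity)
  · dsimp only
    rw [← mul_div_assoc, ← add_div, div_le_one (by positivity)]
    linarith
  · rw [cosMap_eq_polyMap]
    dsimp only
    have e1 : π * ((arccos c - arccos d) / (2 * π) + (arccos c + arccos d) / (2 * π))
        = arccos c := by field_simp; ring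
    have e2 : π * ((arccos c + arccos d) / (2 * π) - (arccos c - arccos d) / (2 * π))
        = arccos d := by field_simp; ring
    rw [e1, e2, ec, ed]

/-! ### Lines are null sets -/

theorem volume_line_eq_zero {a b : ℝ} (c : ℝ) (h : a ≠ 0 ∨ b ≠ 0) :
    volume {z : ℝ × ℝ | a * z.1 + b * z.2 = c} = 0 := by
  let φ : ℝ × ℝ →ₗ[ℝ] ℝ := a • LinearMap.fst ℝ ℝ ℝ + b • LinearMap.snd ℝ ℝ ℝ
  have hs : ({z : ℝ × ℝ | a * z.1 + b * z.2 = c} : Set (ℝ × ℝ)) =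
      ((AffineSubspace.mk' c ⊥).comap φ.toAffineMap : AffineSubspace ℝ (ℝ × ℝ)) := by
    ext z
    simp [φ, AffineSubspace.mem_mk', sub_eq_zero]
  rw [hs]
  apply Measure.addHaar_affineSubspace
  intro htop
  have h1 : ∀ z : ℝ × ℝ, a * z.1 + b * z.2 = c := fun z => by
    change z ∈ ({z : ℝ × ℝ | a * z.1 + b * z.2 = c} : Set (ℝ × ℝ))
    rw [hs, htop]; trivial
  have h00 := h1 (0, 0)
  have h10 := h1 (1, 0)
  have h01 := h1 (0, 1)
  simp only [mul_zero, mul_one, add_zero, zero_add] at h00 h10 h01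
  rcases h with h | h
  · exact h (h10.trans h00.symm)
  · exact h (h01.trans h00.symm)

theorem ae_ne_line {a b : ℝ} (c : ℝ) (h : a ≠ 0 ∨ b ≠ 0) :
    ∀ᵐ z : ℝ × ℝ, a * z.1 + b * z.2 ≠ c := by
  rw [ae_iff]
  simpa using volume_line_eq_zero c h

/-! ### The change of variables -/

theorem measurableSet_fundTriangle : MeasurableSet fundTriangle :=
  (measurableSet_le measurable_const measurable_fst).inter
    ((measurableSet_le measurable_fst measurable_snd).inter
      (measurableSet_le (measurable_fst.add (measurable_snd.const_mul 2)) measurable_const))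

theorem continuous_cosMap : Continuous cosMap := by
  unfold cosMap; fun_prop

/-- The constant in the change of variables. -/
noncomputable def jacConst : ℝ :=
  (4 * π ^ 2) ^ (-1 / 2 + -1 / 2 : ℝ) / (3 : ℝ) ^ (2 * (-1 / 2) + -1 / 2 : ℝ) *
    (4 / 3 : ℝ) ^ (-1 / 2 : ℝ) * (4 / 9 : ℝ) ^ (-1 / 2 : ℝ) * (16 * π ^ 2 / 9)

theorem jacConst_pos : 0 < jacConst := by
  unfold jacConst; positivity

theorem mul_sq_rpow_neg_half {a A : ℝ} (ha : 0 ≤ a) (hA : 0 < A) :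
    (a * A ^ 2) ^ (-1 / 2 : ℝ) * A = a ^ (-1 / 2 : ℝ) := by
  rw [mul_rpow ha (by positivity), ← rpow_natCast A 2, ← rpow_mul hA.le,
    show ((2 : ℕ) : ℝ) * (-1 / 2) = -1 by norm_num, rpow_neg_one, mul_assoc,
    inv_mul_cancel₀ hA.ne', mul_one]

theorem abs_det_mul_weight {z : ℝ × ℝ} (h1 : 0 < z.1) (h2 : z.1 < z.2) (h3 : z.1 + 2 * z.2 < 1) :
    |(fderivCosMap z).det| * weight (-1 / 2) (-1 / 2) (cosMap z) = jacConst := by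
  obtain ⟨u, v⟩ := z
  dsimp only at h1 h2 h3
  have hπ := pi_pos
  rw [det_fderivCosMap, weight, bdry₁_cosMap, bdry₂_cosMap]
  dsimp only
  have hA : 0 < sin (π * (u + v)) * (cos (π * (v - u)) - cos (π * (u + v))) := by
    apply mul_pos (sin_pos_of_pos_of_lt_pi (by nlinarith) (by nlinarith))
    exact sub_pos.2 (cos_lt_cos_of_nonneg_of_le_pi (by nlinarith) (by nlinarith) (by nlinarith))
  have hB : 0 < sin (π * (v - u)) * (cos (π * (v - u)) - 4 * cos (π * (u + v)) ^ 3
      + 3 * cos (π * (u + v))) := by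
    apply mul_pos (sin_pos_of_pos_of_lt_pi (by nlinarith) (by nlinarith))
    -- The cubic is `cos 3π(u + v)`; the difference of cosines becomes a product of sines of angles
    -- in `(0, π)`.
    have e : cos (π * (v - u)) - 4 * cos (π * (u + v)) ^ 3 + 3 * cos (π * (u + v))
        = 2 * sin (π * (u + 2 * v)) * sin (π * (2 * u + v)) := by
      have e1 := cos_sub_cos (π * (v - u)) (3 * (π * (u + v)))
      rw [cos_three_mul, show (π * (v - u) + 3 * (π * (u + v))) / 2 = π * (u + 2 * v) by ring,
        show (π * (v - u) - 3 * (π * (u + v))) / 2 = -(π * (2 * u + v)) by ring, sin_neg] at e1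
      linear_combination e1
    rw [e]
    have s1 : 0 < sin (π * (u + 2 * v)) := sin_pos_of_pos_of_lt_pi (by nlinarith) (by nlinarith)
    have s2 : 0 < sin (π * (2 * u + v)) := sin_pos_of_pos_of_lt_pi (by nlinarith) (by nlinarith)
    positivity
  set A := sin (π * (u + v)) * (cos (π * (v - u)) - cos (π * (u + v)))
  set B := sin (π * (v - u)) * (cos (π * (v - u)) - 4 * cos (π * (u + v)) ^ 3
      + 3 * cos (π * (u + v)))
  rw [abs_of_nonneg (by positivity), jacConst,
    ← mul_sq_rpow_neg_half (by norm_num : (0 : ℝ) ≤ 4 / 3) hA,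
    ← mul_sq_rpow_neg_half (by norm_num : (0 : ℝ) ≤ 4 / 9) hB]
  ring

/-- On the edges the real power of zero is a default value, so the weight is controlled only in the
interior. -/
theorem ae_fundTriangle_interior :
    ∀ᵐ z : ℝ × ℝ, z ∈ fundTriangle → 0 < z.1 ∧ z.1 < z.2 ∧ z.1 + 2 * z.2 < 1 := by
  filter_upwards [ae_ne_line (a := 1) (b := 0) 0 (by simp),
    ae_ne_line (a := 1) (b := -1) 0 (by simp),
    ae_ne_line (a := 1) (b := 2) 1 (by simp)] with z h1 h2 h3 ⟨h1', h2', h3'⟩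
  refine ⟨lt_of_le_of_ne h1' ?_, lt_of_le_of_ne h2' ?_, lt_of_le_of_ne h3' ?_⟩
  · intro h; apply h1; linarith
  · intro h; apply h2; linarith
  · intro h; apply h3; linarith

theorem fundTriangle_subset : fundTriangle ⊆ Icc 0 1 ×ˢ Icc 0 1 := by
  rintro z ⟨h1, h2, h3⟩
  exact ⟨⟨h1, by linarith⟩, ⟨by linarith, by linarith⟩⟩

theorem integrableOn_fundTriangle {g : ℝ × ℝ → ℝ} (hg : Continuous g) :
    IntegrableOn g fundTriangle :=
  (hg.continuousOn.integrableOn_compact (isCompact_Icc.prod isCompact_Icc)).mono_set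
    fundTriangle_subset

theorem integral_triangleStar {g : ℝ × ℝ → ℝ} (hg : Continuous g) :
    IntegrableOn (fun p => g p * weight (-1 / 2) (-1 / 2) p) triangleStar ∧
      ∫ p in triangleStar, g p * weight (-1 / 2) (-1 / 2) p =
        jacConst * ∫ z in fundTriangle, g (cosMap z) := by
  have hd : ∀ z ∈ fundTriangle, HasFDerivWithinAt cosMap (fderivCosMap z) fundTriangle z :=
    fun z _ => (hasFDerivAt_cosMap z).hasFDerivWithinAt
  have hae : ∀ᵐ z : ℝ × ℝ, z ∈ fundTriangle → |(fderivCosMap z).det| •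
      (g (cosMap z) * weight (-1 / 2) (-1 / 2) (cosMap z)) = jacConst * g (cosMap z) := by
    filter_upwards [ae_fundTriangle_interior] with z hz hzT
    obtain ⟨h1, h2, h3⟩ := hz hzT
    rw [← abs_det_mul_weight h1 h2 h3, smul_eq_mul]
    ring
  rw [← image_cosMap_fundTriangle]
  constructor
  · rw [integrableOn_image_iff_integrableOn_abs_det_fderiv_smul volume measurableSet_fundTriangle hd
      injOn_cosMap]
    refine IntegrableOn.congr_fun_ae (f := fun z => jacConst * g (cosMap z)) ?_ ?_
    · exact (integrableOn_fundTriangle (hg.comp continuous_cosMap)).const_mul jacConst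
    · exact (ae_restrict_iff' measurableSet_fundTriangle).2
        (hae.mono fun z hz hzT => (hz hzT).symm)
  · rw [integral_image_eq_integral_abs_det_fderiv_smul volume measurableSet_fundTriangle hd
      injOn_cosMap, setIntegral_congr_ae measurableSet_fundTriangle hae, integral_const_mul]

/-! ### Unfolding the triangle to the unit square -/

theorem setIntegral_preimage_affine_involution {a b c a' b' c' : ℝ} (hdet : |a * b' - b * a'| = 1)
    {e : ℝ × ℝ → ℝ × ℝ} (he : ∀ z, e z = (a * z.1 + b * z.2 + c, a' * z.1 + b' * z.2 + c'))
    (hee : Function.Involutive e) {S : Set (ℝ × ℝ)} (hS : MeasurableSet S) {F : ℝ × ℝ → ℝ}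
    (hF : ∀ z, F (e z) = F z) : ∫ z in e ⁻¹' S, F z = ∫ z in S, F z := by
  have hfun : e = fun z => (a * z.1 + b * z.2 + c, a' * z.1 + b' * z.2 + c') := funext he
  have hcont : Continuous e := by rw [hfun]; fun_prop
  have hd : ∀ z, HasFDerivAt e (LinearMap.toContinuousLinearMap (Matrix.toLin
      (Module.Basis.finTwoProd ℝ) (Module.Basis.finTwoProd ℝ) !![a, b; a', b'])) z := by
    intro z
    rw [Matrix.toLin_finTwoProd_toContinuousLinearMap, hfun]
    exact (((hasFDerivAt_fst.const_mul a).add (hasFDerivAt_snd.const_mul b)).add_const c).prodMk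
      (((hasFDerivAt_fst.const_mul a').add (hasFDerivAt_snd.const_mul b')).add_const c')
  have h := integral_image_eq_integral_abs_det_fderiv_smul volume (hcont.measurable hS)
    (fun z _ => (hd z).hasFDerivWithinAt) hee.injective.injOn F
  rw [image_preimage_eq _ hee.surjective] at h
  rw [h]
  simp only [ContinuousLinearMap.det, LinearMap.coe_toContinuousLinearMap,
    LinearMap.det_toLin, Matrix.det_fin_two_of, hdet, one_smul, hF]

theorem setIntegral_eq_add_of_ae {S A B : Set (ℝ × ℝ)} {F : ℝ × ℝ → ℝ}
    (hB : MeasurableSet B) (hFA : IntegrableOn F A) (hFB : IntegrableOn F B)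
    (h : ∀ᵐ z : ℝ × ℝ, (z ∈ S ↔ z ∈ A ∨ z ∈ B) ∧ ¬ (z ∈ A ∧ z ∈ B)) :
    ∫ z in S, F z = (∫ z in A, F z) + ∫ z in B, F z := by
  have h1 : S =ᵐ[volume] (A ∪ B : Set (ℝ × ℝ)) := by
    filter_upwards [h] with z hz
    exact propext hz.1
  have h2 : AEDisjoint volume A B := by
    have := h.mono fun z hz => hz.2
    rw [ae_iff] at this
    simp only [not_not] at this
    exact this
  rw [setIntegral_congr_set h1, setIntegral_union₀ h2 hB.nullMeasurableSet hFA hFB]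

/-- The point reflection splits the square into two simplices. In the barycentric coordinates `u`,
`v`, `1 - u - v` the other two symmetries generate all permutations, which cut a simplex into six
copies of the triangle where they are increasing. -/
theorem integral_unitSquare_eq {F : ℝ × ℝ → ℝ} (hF : Continuous F)
    (h1 : ∀ u v, F (v, u) = F (u, v)) (h2 : ∀ u v, F (u, 1 - u - v) = F (u, v))
    (h3 : ∀ u v, F (1 - u, 1 - v) = F (u, v)) :
    ∫ z in Ioc (0 : ℝ) 1 ×ˢ Ioc (0 : ℝ) 1, F z = 12 * ∫ z in fundTriangle, F z := by
  have hint : ∀ S : Set (ℝ × ℝ), S ⊆ Icc 0 1 ×ˢ Icc 0 1 → IntegrableOn F S := fun S hS =>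
    (hF.continuousOn.integrableOn_compact (isCompact_Icc.prod isCompact_Icc)).mono_set hS
  let eN : ℝ × ℝ → ℝ × ℝ := fun z => (1 - z.1, 1 - z.2)
  let e12 : ℝ × ℝ → ℝ × ℝ := fun z => (z.2, z.1)
  let e23 : ℝ × ℝ → ℝ × ℝ := fun z => (z.1, 1 - z.1 - z.2)
  let e13 : ℝ × ℝ → ℝ × ℝ := fun z => (1 - z.1 - z.2, z.2)
  have h4 : ∀ u v, F (1 - u - v, v) = F (u, v) := fun u v => by
    rw [h1, show 1 - u - v = 1 - v - u by ring, h2, h1]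
  let D : Set (ℝ × ℝ) := {z | 0 ≤ z.1 ∧ 0 ≤ z.2 ∧ z.1 + z.2 ≤ 1}
  let B : Set (ℝ × ℝ) := {z | 0 ≤ z.1 ∧ z.1 ≤ z.2 ∧ z.1 + z.2 ≤ 1}
  let B' : Set (ℝ × ℝ) := {z | 0 ≤ z.1 ∧ z.1 ≤ z.2 ∧ 2 * z.1 + z.2 ≤ 1}
  have hDm : MeasurableSet D :=
    (measurableSet_le measurable_const measurable_fst).inter
      ((measurableSet_le measurable_const measurable_snd).inter
        (measurableSet_le (measurable_fst.add measurable_snd) measurable_const))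
  have hBm : MeasurableSet B :=
    (measurableSet_le measurable_const measurable_fst).inter
      ((measurableSet_le measurable_fst measurable_snd).inter
        (measurableSet_le (measurable_fst.add measurable_snd) measurable_const))
  have hTm := measurableSet_fundTriangle
  have cN : Measurable eN := Continuous.measurable (by fun_prop)
  have c12 : Measurable e12 := Continuous.measurable (by fun_prop)
  have c23 : Measurable e23 := Continuous.measurable (by fun_prop)
  have c13 : Measurable e13 := Continuous.measurable (by fun_prop)
  have iN : ∀ {S}, MeasurableSet S → ∫ z in eN ⁻¹' S, F z = ∫ z in S, F z := fun {S} hS =>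
    setIntegral_preimage_affine_involution (a := -1) (b := 0) (c := 1) (a' := 0) (b' := -1)
      (c' := 1) (by norm_num) (fun z => by ext <;> simp [eN] <;> ring)
      (fun z => by ext <;> simp [eN]) hS (fun z => h3 _ _)
  have i12 : ∀ {S}, MeasurableSet S → ∫ z in e12 ⁻¹' S, F z = ∫ z in S, F z := fun {S} hS =>
    setIntegral_preimage_affine_involution (a := 0) (b := 1) (c := 0) (a' := 1) (b' := 0)
      (c' := 0) (by norm_num) (fun z => by ext <;> simp [e12])
      (fun z => by ext <;> simp [e12]) hS (fun z => h1 _ _)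
  have i23 : ∀ {S}, MeasurableSet S → ∫ z in e23 ⁻¹' S, F z = ∫ z in S, F z := fun {S} hS =>
    setIntegral_preimage_affine_involution (a := 1) (b := 0) (c := 0) (a' := -1) (b' := -1)
      (c' := 1) (by norm_num) (fun z => by ext <;> simp [e23]; ring)
      (fun z => by ext <;> simp [e23]) hS (fun z => h2 _ _)
  have i13 : ∀ {S}, MeasurableSet S → ∫ z in e13 ⁻¹' S, F z = ∫ z in S, F z := fun {S} hS =>
    setIntegral_preimage_affine_involution (a := -1) (b := -1) (c := 1) (a' := 0) (b' := 1)
      (c' := 0) (by norm_num) (fun z => by ext <;> simp [e13]; ring)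
      (fun z => by ext <;> simp [e13]; ring) hS (fun z => h4 _ _)
  have s1 : ∫ z in Ioc (0 : ℝ) 1 ×ˢ Ioc (0 : ℝ) 1, F z
      = (∫ z in D, F z) + ∫ z in eN ⁻¹' D, F z := by
    refine setIntegral_eq_add_of_ae (cN hDm) (hint _ ?_) (hint _ ?_) ?_
    · rintro z ⟨_, _, _⟩; exact ⟨⟨by linarith, by linarith⟩, ⟨by linarith, by linarith⟩⟩
    · rintro z ⟨_, _, _⟩; dsimp only [eN] at *
      exact ⟨⟨by linarith, by linarith⟩, ⟨by linarith, by linarith⟩⟩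
    · filter_upwards [ae_ne_line (a := 1) (b := 1) 1 (by simp),
        ae_ne_line (a := 1) (b := 0) 0 (by simp), ae_ne_line (a := 0) (b := 1) 0 (by simp)]
        with ⟨u, v⟩ n1 n2 n3
      simp only [D, eN, mem_prod, mem_Ioc, mem_ofPred_eq, mem_preimage, one_mul, zero_mul,
        add_zero, zero_add] at n1 n2 n3 ⊢
      clear * - n1 n2 n3
      grind (splits := 20)
  have s2 : ∫ z in D, F z = (∫ z in B, F z) + ∫ z in e12 ⁻¹' B, F z := by
    refine setIntegral_eq_add_of_ae (c12 hBm) (hint _ ?_) (hint _ ?_) ?_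
    · rintro z ⟨_, _, _⟩; exact ⟨⟨by linarith, by linarith⟩, ⟨by linarith, by linarith⟩⟩
    · rintro z ⟨_, _, _⟩; dsimp only [e12] at *
      exact ⟨⟨by linarith, by linarith⟩, ⟨by linarith, by linarith⟩⟩
    · filter_upwards [ae_ne_line (a := 1) (b := -1) 0 (by simp)] with ⟨u, v⟩ n1
      simp only [D, B, e12, mem_ofPred_eq, mem_preimage] at n1 ⊢
      clear * - n1
      grind (splits := 20)
  have s3 : ∫ z in B, F z = (∫ z in B', F z) + ∫ z in e13 ⁻¹' (e23 ⁻¹' fundTriangle), F z := by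
    refine setIntegral_eq_add_of_ae (c13 (c23 hTm)) (hint _ ?_) (hint _ ?_) ?_
    · rintro z ⟨_, _, _⟩; exact ⟨⟨by linarith, by linarith⟩, ⟨by linarith, by linarith⟩⟩
    · rintro z ⟨_, _, _⟩; dsimp only [e13, e23] at *
      exact ⟨⟨by linarith, by linarith⟩, ⟨by linarith, by linarith⟩⟩
    · filter_upwards [ae_ne_line (a := 2) (b := 1) 1 (by simp)] with ⟨u, v⟩ n1
      simp only [B, B', e13, e23, fundTriangle, mem_ofPred_eq, mem_preimage] at n1 ⊢
      clear * - n1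
      grind (splits := 20)
  have s4 : ∫ z in B', F z = (∫ z in fundTriangle, F z) + ∫ z in e23 ⁻¹' fundTriangle, F z := by
    refine setIntegral_eq_add_of_ae (c23 hTm) (hint _ fundTriangle_subset) (hint _ ?_) ?_
    · rintro z ⟨_, _, _⟩; dsimp only [e23] at *
      exact ⟨⟨by linarith, by linarith⟩, ⟨by linarith, by linarith⟩⟩
    · filter_upwards [ae_ne_line (a := 1) (b := 2) 1 (by simp)] with ⟨u, v⟩ n1
      simp only [B', e23, fundTriangle, mem_ofPred_eq, mem_preimage] at n1 ⊢
      clear * - n1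
      grind (splits := 20)
  rw [s1, iN hDm, s2, i12 hBm, s3, i13 (c23 hTm), s4, i23 hTm]
  ring

/-! ### Symmetries of the generalized cosines -/

theorem cosMap_eq_of_angles {u v u' v' : ℝ}
    (h1 : cos (2 * π * u) + cos (2 * π * v) + cos (2 * π * (u + v))
      = cos (2 * π * u') + cos (2 * π * v') + cos (2 * π * (u' + v')))
    (h2 : cos (2 * π * (2 * u + v)) + cos (2 * π * (v - u)) + cos (2 * π * (u + 2 * v))
      = cos (2 * π * (2 * u' + v')) + cos (2 * π * (v' - u')) + cos (2 * π * (u' + 2 * v'))) :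
    cosMap (u, v) = cosMap (u', v') := by
  simp only [cosMap, h1, h2]

theorem cos_two_pi_mul_int_sub (x : ℝ) (k : ℤ) : cos (2 * π * (k - x)) = cos (2 * π * x) := by
  rw [show 2 * π * (k - x) = k * (2 * π) - 2 * π * x by ring, cos_int_mul_two_pi_sub]

theorem cosMap_swap (u v : ℝ) : cosMap (v, u) = cosMap (u, v) := by
  apply cosMap_eq_of_angles
  · rw [add_comm v u]; ring
  · have := cos_two_pi_mul_int_sub (v - u) 0
    rw [Int.cast_zero, show (0 : ℝ) - (v - u) = u - v by ring] at this
    rw [this, show 2 * v + u = u + 2 * v by ring, show v + 2 * u = 2 * u + v by ring]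
    ring

theorem cosMap_reflect (u v : ℝ) : cosMap (u, 1 - u - v) = cosMap (u, v) := by
  apply cosMap_eq_of_angles
  · have a1 := cos_two_pi_mul_int_sub (u + v) 1
    have a2 := cos_two_pi_mul_int_sub v 1
    rw [Int.cast_one] at a1 a2
    rw [show 1 - u - v = 1 - (u + v) by ring, a1, show u + (1 - (u + v)) = 1 - v by ring, a2]
    ring
  · have a1 := cos_two_pi_mul_int_sub (v - u) 1
    have a2 := cos_two_pi_mul_int_sub (2 * u + v) 1
    have a3 := cos_two_pi_mul_int_sub (u + 2 * v) 2
    rw [Int.cast_one] at a1 a2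
    rw [Int.cast_ofNat] at a3
    rw [show 2 * u + (1 - u - v) = 1 - (v - u) by ring, a1,
      show 1 - u - v - u = 1 - (2 * u + v) by ring, a2,
      show u + 2 * (1 - u - v) = 2 - (u + 2 * v) by ring, a3]
    ring

theorem cosMap_one_sub (u v : ℝ) : cosMap (1 - u, 1 - v) = cosMap (u, v) := by
  apply cosMap_eq_of_angles
  · have a1 := cos_two_pi_mul_int_sub u 1
    have a2 := cos_two_pi_mul_int_sub v 1
    have a3 := cos_two_pi_mul_int_sub (u + v) 2
    rw [Int.cast_one] at a1 a2
    rw [Int.cast_ofNat] at a3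
    rw [a1, a2, show 1 - u + (1 - v) = 2 - (u + v) by ring, a3]
  · have a1 := cos_two_pi_mul_int_sub (v - u) 0
    have a2 := cos_two_pi_mul_int_sub (2 * u + v) 3
    have a3 := cos_two_pi_mul_int_sub (u + 2 * v) 3
    rw [Int.cast_zero] at a1
    rw [Int.cast_ofNat] at a2 a3
    rw [show 2 * (1 - u) + (1 - v) = 3 - (2 * u + v) by ring, a2,
      show 1 - v - (1 - u) = 0 - (v - u) by ring, a1,
      show 1 - u + 2 * (1 - v) = 3 - (u + 2 * v) by ring, a3]

/-! ### Unfolding the index set -/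

/-- The lattice points of the simplex `k, l ≥ 0`, `k + l ≤ n`. -/
noncomputable def simplexPoints (n : ℕ) : Finset (ℤ × ℤ) :=
  (Finset.Icc (0 : ℤ) n ×ˢ Finset.Icc (0 : ℤ) n).filter fun a => a.1 + a.2 ≤ n

theorem mem_simplexPoints {n : ℕ} {a : ℤ × ℤ} :
    a ∈ simplexPoints n ↔ 0 ≤ a.1 ∧ 0 ≤ a.2 ∧ a.1 + a.2 ≤ n := by
  simp only [simplexPoints, Finset.mem_filter, Finset.mem_product, Finset.mem_Icc]
  omega

theorem sum_simplexPoints_swap (n : ℕ) (φ : ℤ → ℤ → ℤ → ℝ) :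
    ∑ a ∈ simplexPoints n, φ a.2 a.1 (n - a.1 - a.2)
      = ∑ a ∈ simplexPoints n, φ a.1 a.2 (n - a.1 - a.2) := by
  refine Finset.sum_nbij' (fun a => (a.2, a.1)) (fun a => (a.2, a.1)) ?_ ?_ ?_ ?_ ?_
  · intro a; simp only [mem_simplexPoints]; omega
  · intro a; simp only [mem_simplexPoints]; omega
  · intro a _; rfl
  · intro a _; rfl
  · intro a _; dsimp only; congr 1; ring

theorem sum_simplexPoints_reflect (n : ℕ) (φ : ℤ → ℤ → ℤ → ℝ) :
    ∑ a ∈ simplexPoints n, φ a.1 (n - a.1 - a.2) a.2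
      = ∑ a ∈ simplexPoints n, φ a.1 a.2 (n - a.1 - a.2) := by
  refine Finset.sum_nbij' (fun a => (a.1, n - a.1 - a.2)) (fun a => (a.1, n - a.1 - a.2))
    ?_ ?_ ?_ ?_ ?_
  · intro a; simp only [mem_simplexPoints]; omega
  · intro a; simp only [mem_simplexPoints]; omega
  · intro a _; ext <;> simp
  · intro a _; ext <;> simp
  · intro a _; dsimp only; congr 1; ring

/-- Points with `k + l < n` stay; the others are reflected, and `k, l < n` turns into strict
positivity. Thus the half-open square is counted without duplication. -/
theorem sum_square_eq_sum_simplexPoints (n : ℕ) {f : ℤ → ℤ → ℝ}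
    (h : ∀ k l, f (n - k) (n - l) = f k l) :
    ∑ a ∈ Finset.Ico (0 : ℤ) n ×ˢ Finset.Ico (0 : ℤ) n, f a.1 a.2
      = ∑ a ∈ simplexPoints n, ((if 0 < (n : ℤ) - a.1 - a.2 then 1 else 0)
        + (if 0 < a.1 ∧ 0 < a.2 then 1 else 0)) * f a.1 a.2 := by
  simp only [add_mul, ite_mul, one_mul, zero_mul]
  rw [Finset.sum_add_distrib, ← Finset.sum_filter, ← Finset.sum_filter,
    ← Finset.sum_filter_add_sum_filter_not _ (fun a : ℤ × ℤ => a.1 + a.2 < n)]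
  congr 1
  · apply Finset.sum_congr _ fun _ _ => rfl
    ext a
    simp only [Finset.mem_filter, mem_simplexPoints, Finset.mem_product, Finset.mem_Ico]
    omega
  · refine Finset.sum_nbij' (fun a => (n - a.1, n - a.2)) (fun a => (n - a.1, n - a.2))
      ?_ ?_ ?_ ?_ ?_
    · intro a
      simp only [Finset.mem_filter, mem_simplexPoints, Finset.mem_product, Finset.mem_Ico]
      omega
    · intro a
      simp only [Finset.mem_filter, mem_simplexPoints, Finset.mem_product, Finset.mem_Ico]
      omega
    · intro a _; ext <;> simp
    · intro a _; ext <;> simp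
    · intro a _; exact (h _ _).symm

/-- The indicator of sorted triples. -/
noncomputable def sortedInd (k l m : ℤ) : ℝ := if k ≤ l ∧ l ≤ m then 1 else 0

/-- The inverse of the order of the stabilizer of a triple under permutations. -/
noncomputable def stabInv (k l m : ℤ) : ℝ :=
  if k = l ∧ l = m then 1 / 6 else if k = l ∨ l = m ∨ k = m then 1 / 2 else 1

/-- The weight of a lattice point of the simplex in the sum over the unit square. -/
noncomputable def simplexWeight (k l m : ℤ) : ℝ :=
  (if 0 < m then 1 else 0) + if 0 < k ∧ 0 < l then 1 else 0

/-- Orbit–stabilizer: the permutations sorting a triple form a coset of its stabilizer. -/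
theorem stabInv_mul_sum_sortedInd (k l m : ℤ) :
    stabInv k l m * (sortedInd k l m + sortedInd l k m + sortedInd k m l + sortedInd m k l
      + sortedInd l m k + sortedInd m l k) = 1 := by
  have key : ∀ a b : ℤ, (a ≤ b ∧ ¬ b ≤ a ∧ a ≠ b ∧ b ≠ a) ∨ a = b ∨
      (b ≤ a ∧ ¬ a ≤ b ∧ a ≠ b ∧ b ≠ a) := by omega
  rcases key k l with ⟨h1, h2, h3, h4⟩ | h1 | ⟨h1, h2, h3, h4⟩ <;>
    rcases key l m with ⟨h5, h6, h7, h8⟩ | h5 | ⟨h5, h6, h7, h8⟩ <;>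
    rcases key k m with ⟨h9, h10, h11, h12⟩ | h9 | ⟨h9, h10, h11, h12⟩ <;>
    first
    | omega
    | (simp [stabInv, sortedInd, *]; done)
    | (simp [stabInv, sortedInd, *]; norm_num)

theorem stabInv_swap (k l m : ℤ) : stabInv l k m = stabInv k l m := by
  unfold stabInv; split_ifs <;> first | rfl | omega

theorem stabInv_reflect (k l m : ℤ) : stabInv k m l = stabInv k l m := by
  unfold stabInv; split_ifs <;> first | rfl | omega

theorem omega_eq (n : ℕ) {k l : ℤ} (hk : 0 ≤ k) (hkl : k ≤ l) (hl : k + 2 * l ≤ n) :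
    omega n ![2 * k + l, l - k, -k - 2 * l] = if 0 < k ∧ k < l ∧ k + 2 * l < n then 12 else
      if k = 0 ∧ l = 0 then 1 else if k = l ∧ 3 * k = n then 2 else
      if k = 0 ∧ 2 * l = n then 3 else 6 := by
  simp only [omega, Matrix.cons_val_zero, Matrix.cons_val_one, Matrix.cons_val]
  exact if_congr (by omega) rfl (if_congr (by omega) rfl (if_congr (by omega) rfl
    (if_congr (by omega) rfl rfl)))

theorem stabInv_mul_sum_simplexWeight {n : ℕ} (hn : 1 ≤ n) {k l m : ℤ} (hk : 0 ≤ k) (hkl : k ≤ l)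
    (hl : l ≤ m) (hsum : k + l + m = n) :
    stabInv k l m * (simplexWeight k l m + simplexWeight l k m + simplexWeight k m l
      + simplexWeight m k l + simplexWeight l m k + simplexWeight m l k)
      = omega n ![2 * k + l, l - k, -k - 2 * l] := by
  have hm : 0 < m := by omega
  rw [omega_eq n hk hkl (by omega)]
  unfold stabInv simplexWeight
  rcases hk.eq_or_lt with rfl | hk
  · rcases hkl.eq_or_lt with rfl | hkl
    · simp [hm, hm.ne]; norm_num
    · rcases hl.eq_or_lt with rfl | hl
      · simp only [hkl, lt_irrefl, false_and, and_false, and_self, true_and, and_true,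
          or_true, true_or, if_true, if_false]
        split_ifs <;> first | omega | norm_num
      · simp only [hkl, hm, lt_irrefl, false_and, and_false, and_self, true_and, if_true, if_false]
        split_ifs <;> first | omega | norm_num
  · have hl0 : 0 < l := by omega
    simp only [hk, hl0, hm, and_self, if_true, true_and]
    split_ifs <;> first | omega | norm_num

theorem mem_Upsilon {n : ℕ} {j : Fin 3 → ℤ} : j ∈ Upsilon n ↔
    j 0 + j 1 + j 2 = 0 ∧ j 0 % 3 = j 1 % 3 ∧ j 1 % 3 = j 2 % 3 ∧
      0 ≤ j 1 ∧ j 1 ≤ j 0 ∧ j 0 ≤ -j 2 ∧ -j 2 ≤ (n : ℤ) := by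
  rw [Upsilon, Finset.mem_filter, Fintype.mem_piFinset]
  simp only [Fin.forall_fin_succ, Finset.mem_Icc, Int.ModEq, Fin.succ_zero_eq_one,
    Fin.succ_one_eq_two, IsEmpty.forall_iff, and_true]
  omega

/-- The congruences modulo 3 in `Upsilon` make both integer divisions exact. -/
theorem sum_simplexPoints_eq_sum_Upsilon (n : ℕ) (g : ℤ → ℤ → (Fin 3 → ℤ) → ℝ) :
    ∑ a ∈ (simplexPoints n).filter (fun a => a.1 ≤ a.2 ∧ a.2 ≤ (n : ℤ) - a.1 - a.2),
        g a.1 a.2 ![2 * a.1 + a.2, a.2 - a.1, -a.1 - 2 * a.2]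
      = ∑ j ∈ Upsilon n, g ((j 0 - j 1) / 3) ((j 1 - j 2) / 3) j := by
  refine Finset.sum_nbij' (fun a => ![2 * a.1 + a.2, a.2 - a.1, -a.1 - 2 * a.2])
    (fun j => ((j 0 - j 1) / 3, (j 1 - j 2) / 3)) ?_ ?_ ?_ ?_ ?_
  · intro a
    rw [mem_Upsilon, Finset.mem_filter, mem_simplexPoints]
    simp only [Matrix.cons_val_zero, Matrix.cons_val_one, Matrix.cons_val]
    omega
  · intro j
    rw [mem_Upsilon, Finset.mem_filter, mem_simplexPoints]
    dsimp only
    omega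
  · intro a _
    simp only [Matrix.cons_val_zero, Matrix.cons_val_one, Matrix.cons_val]
    ext <;> dsimp only <;> omega
  · intro j hj
    rw [mem_Upsilon] at hj
    funext i
    fin_cases i <;> simp <;> omega
  · intro a _
    simp only [Matrix.cons_val_zero, Matrix.cons_val_one, Matrix.cons_val]
    congr 1 <;> omega

/-- Insert the partition of unity by sorting permutations, then move each permutation from the
indicator onto the weight; only sorted triples remain, with the symmetrized weight. -/
theorem sum_square_eq_sum_Upsilon {n : ℕ} (hn : 1 ≤ n) {f : ℤ → ℤ → ℝ}
    (h1 : ∀ k l, f l k = f k l) (h2 : ∀ k l, f k (n - k - l) = f k l)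
    (h3 : ∀ k l, f (n - k) (n - l) = f k l) :
    ∑ a ∈ Finset.Ico (0 : ℤ) n ×ˢ Finset.Ico (0 : ℤ) n, f a.1 a.2
      = ∑ j ∈ Upsilon n, (omega n j : ℝ) * f ((j 0 - j 1) / 3) ((j 1 - j 2) / 3) := by
  let W := simplexWeight
  let M := stabInv
  let t := sortedInd
  have key : ∀ φ : ℤ → ℤ → ℤ → ℝ, (∀ k l m : ℤ, k + l + m = n → φ k l m = f k l * M k l m * W k l m
      * (t k l m + t l k m + t k m l + t m k l + t l m k + t m l k)) →
      ∑ a ∈ simplexPoints n, φ a.1 a.2 (n - a.1 - a.2)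
      = ∑ a ∈ simplexPoints n, (fun k l m => f k l * M k l m * t k l m
        * (W k l m + W l k m + W k m l + W m k l + W l m k + W m l k))
          a.1 a.2 (n - a.1 - a.2) := by
    intro φ hφ
    have f1 : ∀ k l m : ℤ, k + l + m = n → f k m = f k l := fun k l m h => by
      rw [← h2 k l]; congr 1; omega
    -- Keeping the sum as an opaque linear functional lets the permutation moves act by rewriting.
    obtain ⟨S, hS⟩ : ∃ S : (ℤ → ℤ → ℤ → ℝ) → ℝ,
        ∀ φ, S φ = ∑ a ∈ simplexPoints n, φ a.1 a.2 (n - a.1 - a.2) := ⟨_, fun _ => rfl⟩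
    have hS1 : ∀ φ : ℤ → ℤ → ℤ → ℝ, S (fun k l m => φ l k m) = S φ := fun φ => by
      rw [hS, hS]; exact sum_simplexPoints_swap n φ
    have hS2 : ∀ φ : ℤ → ℤ → ℤ → ℝ, S (fun k l m => φ k m l) = S φ := fun φ => by
      rw [hS, hS]; exact sum_simplexPoints_reflect n φ
    have hSadd : ∀ φ φ' : ℤ → ℤ → ℤ → ℝ, S (fun k l m => φ k l m + φ' k l m) = S φ + S φ' :=
      fun φ φ' => by rw [hS, hS, hS]; exact Finset.sum_add_distrib
    have hScongr : ∀ φ φ' : ℤ → ℤ → ℤ → ℝ, (∀ k l m : ℤ, k + l + m = n → φ k l m = φ' k l m) →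
        S φ = S φ' := fun φ φ' h => by
      rw [hS, hS]; exact Finset.sum_congr rfl fun a _ => h _ _ _ (by ring)
    have M1 : ∀ k l m, M l k m = M k l m := stabInv_swap
    have M2 : ∀ k l m, M k m l = M k l m := stabInv_reflect
    -- `T` and `R` move one transposition from `τ` to `w`; the rest follow by composition.
    have T : ∀ w τ : ℤ → ℤ → ℤ → ℝ,
        S (fun k l m => f k l * M k l m * w k l m * τ l k m)
          = S (fun k l m => f k l * M k l m * w l k m * τ k l m) := fun w τ => by
      refine Eq.trans ?_ (hS1 (fun k l m => f k l * M k l m * w l k m * τ k l m))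
      exact hScongr _ _ fun k l m _ => by rw [h1, M1]
    have R : ∀ w τ : ℤ → ℤ → ℤ → ℝ,
        S (fun k l m => f k l * M k l m * w k l m * τ k m l)
          = S (fun k l m => f k l * M k l m * w k m l * τ k l m) := fun w τ => by
      refine Eq.trans ?_ (hS2 (fun k l m => f k l * M k l m * w k m l * τ k l m))
      exact hScongr _ _ fun k l m h => by rw [f1 k l m h, M2]
    refine ((hS φ).symm.trans ?_).trans (hS fun k l m => f k l * M k l m * t k l m
        * (W k l m + W l k m + W k m l + W m k l + W l m k + W m l k))
    refine (hScongr _ _ hφ).trans ?_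
    simp only [mul_add, hSadd]
    have e1 : S (fun k l m => f k l * M k l m * W k l m * t l k m) = _ := T W t
    have e2 : S (fun k l m => f k l * M k l m * W k l m * t k m l) = _ := R W t
    have e3 : S (fun k l m => f k l * M k l m * W k l m * t m k l) =
        S (fun k l m => f k l * M k l m * W l m k * t k l m) :=
      (R W (fun a b c => t b a c)).trans (T (fun a b c => W a c b) t)
    have e4 : S (fun k l m => f k l * M k l m * W k l m * t l m k) =
        S (fun k l m => f k l * M k l m * W m k l * t k l m) :=
      (T W (fun a b c => t a c b)).trans (R (fun a b c => W b a c) t)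
    have e5 : S (fun k l m => f k l * M k l m * W k l m * t m l k) =
        S (fun k l m => f k l * M k l m * W m l k * t k l m) :=
      (T W (fun a b c => t c a b)).trans
        ((R (fun a b c => W b a c) (fun a b c => t b a c)).trans
          (T (fun a b c => W c a b) t))
    rw [e1, e2, e3, e4, e5]
    simp only [← hSadd]
    exact hScongr _ _ fun k l m _ => by ring
  rw [sum_square_eq_sum_simplexPoints n h3,
    ← sum_simplexPoints_eq_sum_Upsilon n (fun k l j => (omega n j : ℝ) * f k l),
    Finset.sum_filter]
  refine (key (fun k l m => ((if 0 < m then 1 else 0) + if 0 < k ∧ 0 < l then 1 else 0) * f k l)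
    fun k l m _ => ?_).trans ?_
  · have := stabInv_mul_sum_sortedInd k l m
    change simplexWeight k l m * f k l = _
    simp only [M, W, t]
    linear_combination (-(f k l * simplexWeight k l m)) * this
  · refine Finset.sum_congr rfl fun a ha => ?_
    obtain ⟨hk, -, -⟩ := mem_simplexPoints.1 ha
    dsimp only
    split_ifs with ht
    · have := stabInv_mul_sum_simplexWeight hn hk ht.1 ht.2 (by ring)
      have ht1 : t a.1 a.2 (n - a.1 - a.2) = 1 := if_pos ht
      rw [ht1]
      simp only [M, W]
      linear_combination f a.1 a.2 * this
    · have ht1 : t a.1 a.2 (n - a.1 - a.2) = 0 := if_neg ht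
      rw [ht1]; ring

/-! ### Trigonometric polynomials -/

/-- The exponential of frequency `(a, b)`. -/
noncomputable def expFun (a b : ℤ) : ℝ × ℝ → ℂ :=
  fun z => Complex.exp (2 * π * Complex.I * a * z.1) * Complex.exp (2 * π * Complex.I * b * z.2)

theorem expFun_mul (a b a' b' : ℤ) : expFun a b * expFun a' b' = expFun (a + a') (b + b') := by
  funext z
  simp only [expFun, Pi.mul_apply, ← Complex.exp_add]
  congr 1
  push_cast
  ring

theorem expFun_zero : expFun 0 0 = 1 := by
  funext z; simp [expFun]

theorem continuous_expFun (a b : ℤ) : Continuous (expFun a b) := by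
  unfold expFun; fun_prop

/-- The exponentials with frequencies in the hexagon of size `d`. -/
def hexExp (d : ℕ) : Set (ℝ × ℝ → ℂ) :=
  {g | ∃ a b : ℤ, |a + b| ≤ d ∧ |2 * a - b| ≤ d ∧ |2 * b - a| ≤ d ∧ g = expFun a b}

/-- The trigonometric polynomials with frequencies in the hexagon of size `d`. -/
noncomputable def trigSpace (d : ℕ) : Submodule ℂ (ℝ × ℝ → ℂ) := Submodule.span ℂ (hexExp d)

theorem trigSpace_mono {d e : ℕ} (h : d ≤ e) : trigSpace d ≤ trigSpace e := by
  apply Submodule.span_mono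
  rintro _ ⟨a, b, h1, h2, h3, rfl⟩
  have : (d : ℤ) ≤ e := by exact_mod_cast h
  exact ⟨a, b, h1.trans this, h2.trans this, h3.trans this, rfl⟩

/-- The hexagon size is a norm on frequencies, hence subadditive. -/
theorem mul_mem_trigSpace {d e : ℕ} {g h : ℝ × ℝ → ℂ} (hg : g ∈ trigSpace d)
    (hh : h ∈ trigSpace e) : g * h ∈ trigSpace (d + e) := by
  have := Submodule.mul_mem_mul hg hh
  rw [trigSpace, trigSpace, Submodule.span_mul_span] at this
  refine Submodule.span_mono ?_ this
  rintro _ ⟨_, ⟨a, b, h1, h2, h3, rfl⟩, _, ⟨a', b', h1', h2', h3', rfl⟩, rfl⟩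
  refine ⟨a + a', b + b', ?_, ?_, ?_, expFun_mul a b a' b'⟩ <;> push_cast <;>
    rw [abs_le] at * <;> omega

theorem one_mem_trigSpace : (1 : ℝ × ℝ → ℂ) ∈ trigSpace 0 :=
  Submodule.subset_span ⟨0, 0, by simp, by simp, by simp, expFun_zero.symm⟩

theorem pow_mem_trigSpace {d : ℕ} {g : ℝ × ℝ → ℂ} (hg : g ∈ trigSpace d) (k : ℕ) :
    g ^ k ∈ trigSpace (d * k) := by
  induction k with
  | zero => simpa using one_mem_trigSpace
  | succ k ih => rw [pow_succ, mul_add, mul_one]; exact mul_mem_trigSpace ih hg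

theorem cos_mem_trigSpace {d : ℕ} (a b : ℤ) (h1 : |a + b| ≤ d) (h2 : |2 * a - b| ≤ d)
    (h3 : |2 * b - a| ≤ d) :
    (fun z : ℝ × ℝ => ((cos (2 * π * (a * z.1 + b * z.2)) : ℝ) : ℂ)) ∈ trigSpace d := by
  have e : (fun z : ℝ × ℝ => ((cos (2 * π * (a * z.1 + b * z.2)) : ℝ) : ℂ))
      = (1 / 2 : ℂ) • expFun a b + (1 / 2 : ℂ) • expFun (-a) (-b) := by
    funext z
    simp only [expFun, Pi.add_apply, Pi.smul_apply, smul_eq_mul, ← Complex.exp_add]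
    rw [Complex.ofReal_cos, Complex.cos]
    push_cast
    rw [show 2 * (π : ℂ) * (a * z.1 + b * z.2) * Complex.I
        = 2 * π * Complex.I * a * z.1 + 2 * π * Complex.I * b * z.2 by ring,
      show -(2 * (π : ℂ) * (a * z.1 + b * z.2)) * Complex.I
        = 2 * π * Complex.I * -a * z.1 + 2 * π * Complex.I * -b * z.2 by ring]
    ring
  rw [e]
  refine add_mem (Submodule.smul_mem _ _ (Submodule.subset_span ⟨a, b, h1, h2, h3, rfl⟩))
    (Submodule.smul_mem _ _ (Submodule.subset_span ⟨-a, -b, ?_, ?_, ?_, rfl⟩)) <;>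
    rw [abs_le] at * <;> omega

theorem cosMap_fst_mem_trigSpace : (fun z => (((cosMap z).1 : ℝ) : ℂ)) ∈ trigSpace 2 := by
  have e : (fun z => (((cosMap z).1 : ℝ) : ℂ)) = (1 / 3 : ℂ) •
      ((fun z : ℝ × ℝ => ((cos (2 * π * ((1 : ℤ) * z.1 + (0 : ℤ) * z.2)) : ℝ) : ℂ))
      + (fun z : ℝ × ℝ => ((cos (2 * π * ((0 : ℤ) * z.1 + (1 : ℤ) * z.2)) : ℝ) : ℂ))
      + (fun z : ℝ × ℝ => ((cos (2 * π * ((1 : ℤ) * z.1 + (1 : ℤ) * z.2)) : ℝ) : ℂ))) := by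
    funext z
    simp only [cosMap, Pi.add_apply, Pi.smul_apply, smul_eq_mul, Int.cast_one, Int.cast_zero,
      one_mul, zero_mul, add_zero, zero_add]
    push_cast
    ring
  rw [e]
  exact Submodule.smul_mem _ _ (add_mem (add_mem
    (cos_mem_trigSpace 1 0 (by norm_num) (by norm_num) (by norm_num))
    (cos_mem_trigSpace 0 1 (by norm_num) (by norm_num) (by norm_num)))
    (cos_mem_trigSpace 1 1 (by norm_num) (by norm_num) (by norm_num)))

theorem cosMap_snd_mem_trigSpace : (fun z => (((cosMap z).2 : ℝ) : ℂ)) ∈ trigSpace 3 := by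
  have e : (fun z => (((cosMap z).2 : ℝ) : ℂ)) = (1 / 3 : ℂ) •
      ((fun z : ℝ × ℝ => ((cos (2 * π * ((2 : ℤ) * z.1 + (1 : ℤ) * z.2)) : ℝ) : ℂ))
      + (fun z : ℝ × ℝ => ((cos (2 * π * ((-1 : ℤ) * z.1 + (1 : ℤ) * z.2)) : ℝ) : ℂ))
      + (fun z : ℝ × ℝ => ((cos (2 * π * ((1 : ℤ) * z.1 + (2 : ℤ) * z.2)) : ℝ) : ℂ))) := by
    funext z
    simp only [cosMap, Pi.add_apply, Pi.smul_apply, smul_eq_mul, Int.cast_one, Int.cast_ofNat,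
      Int.cast_neg, one_mul]
    rw [show z.2 - z.1 = -1 * z.1 + z.2 by ring]
    push_cast
    ring
  rw [e]
  exact Submodule.smul_mem _ _ (add_mem (add_mem
    (cos_mem_trigSpace 2 1 (by norm_num) (by norm_num) (by norm_num))
    (cos_mem_trigSpace (-1) 1 (by norm_num) (by norm_num) (by norm_num)))
    (cos_mem_trigSpace 1 2 (by norm_num) (by norm_num) (by norm_num)))

/-! ### Exactness on the torus -/

theorem integral_exp_eq_zero {a : ℤ} (ha : a ≠ 0) :
    ∫ u in Ioc (0 : ℝ) 1, Complex.exp (2 * π * Complex.I * a * u) = 0 := by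
  have hc : 2 * π * Complex.I * a ≠ 0 :=
    mul_ne_zero Complex.two_pi_I_ne_zero (Int.cast_ne_zero.2 ha)
  rw [← intervalIntegral.integral_of_le zero_le_one, integral_exp_mul_complex hc]
  have : Complex.exp (2 * π * Complex.I * a) = 1 :=
    Complex.exp_eq_one_iff.2 ⟨a, by ring⟩
  simp [this]

theorem integral_expFun {a b : ℤ} (h : a ≠ 0 ∨ b ≠ 0) :
    ∫ z in Ioc (0 : ℝ) 1 ×ˢ Ioc (0 : ℝ) 1, expFun a b z = 0 := by
  unfold expFun
  have := setIntegral_prod_mul (μ := (volume : Measure ℝ)) (ν := (volume : Measure ℝ))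
    (fun u : ℝ => Complex.exp (2 * π * Complex.I * a * u))
    (fun v : ℝ => Complex.exp (2 * π * Complex.I * b * v)) (Ioc (0 : ℝ) 1) (Ioc (0 : ℝ) 1)
  rw [Measure.volume_eq_prod, this]
  rcases h with h | h <;> simp [integral_exp_eq_zero h]

theorem sum_exp_eq_zero {n : ℕ} (hn : 1 ≤ n) {a : ℤ} (ha : ¬ (n : ℤ) ∣ a) :
    ∑ k ∈ Finset.Ico (0 : ℤ) n,
      Complex.exp (2 * π * Complex.I * a * (((k : ℝ) / (n : ℝ) : ℝ) : ℂ)) = 0 := by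
  have hn0 : (n : ℂ) ≠ 0 := by exact_mod_cast (by omega : n ≠ 0)
  set ζ := Complex.exp (2 * π * Complex.I * a / n) with hζ
  have e : ∑ k ∈ Finset.Ico (0 : ℤ) n,
      Complex.exp (2 * π * Complex.I * a * (((k : ℝ) / (n : ℝ) : ℝ) : ℂ))
      = ∑ k ∈ Finset.range n, ζ ^ k := by
    refine Finset.sum_nbij' Int.toNat (fun k => (k : ℤ)) ?_ ?_ ?_ ?_ ?_
    · intro k; simp only [Finset.mem_Ico, Finset.mem_range]; omega
    · intro k; simp only [Finset.mem_Ico, Finset.mem_range]; omega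
    · intro k; simp only [Finset.mem_Ico]; omega
    · intro k _; simp
    · intro k hk
      obtain ⟨m, rfl⟩ := Int.eq_ofNat_of_zero_le (Finset.mem_Ico.1 hk).1
      rw [hζ, ← Complex.exp_nat_mul]
      congr 1
      simp only [Int.toNat_natCast]
      push_cast
      ring
  have hζn : ζ ^ n = 1 := by
    rw [hζ, ← Complex.exp_nat_mul, Complex.exp_eq_one_iff]
    exact ⟨a, by field_simp⟩
  have hζ1 : ζ ≠ 1 := by
    intro h
    rw [hζ, Complex.exp_eq_one_iff] at h
    obtain ⟨m, hm⟩ := h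
    apply ha
    refine ⟨m, ?_⟩
    rw [div_eq_iff hn0] at hm
    have : (a : ℂ) = n * m := by
      apply mul_left_cancel₀ Complex.two_pi_I_ne_zero
      linear_combination hm
    exact_mod_cast this
  rw [e, geom_sum_eq hζ1, hζn, sub_self, zero_div]

theorem sum_expFun {n : ℕ} (hn : 1 ≤ n) {a b : ℤ} (h : ¬ ((n : ℤ) ∣ a ∧ (n : ℤ) ∣ b)) :
    ∑ k ∈ Finset.Ico (0 : ℤ) n ×ˢ Finset.Ico (0 : ℤ) n,
      expFun a b ((k.1 : ℝ) / (n : ℝ), (k.2 : ℝ) / (n : ℝ)) = 0 := by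
  unfold expFun
  rw [Finset.sum_product]
  dsimp only
  rw [← Finset.sum_mul_sum]
  rcases not_and_or.1 h with h | h
  · rw [sum_exp_eq_zero hn h, zero_mul]
  · rw [sum_exp_eq_zero hn h, mul_zero]

/-- A nonzero point of `nℤ²` has hexagon size at least `2n`; this is where the degree `2n - 1`
enters. -/
theorem eq_zero_of_dvd_of_hex {n : ℕ} (hn : 1 ≤ n) {a b : ℤ}
    (h1 : |a + b| ≤ (2 * n - 1 : ℕ)) (h2 : |2 * a - b| ≤ (2 * n - 1 : ℕ))
    (h3 : |2 * b - a| ≤ (2 * n - 1 : ℕ)) (ha : (n : ℤ) ∣ a) (hb : (n : ℤ) ∣ b) :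
    a = 0 ∧ b = 0 := by
  obtain ⟨p, rfl⟩ := ha
  obtain ⟨q, rfl⟩ := hb
  have hn' : ((2 * n - 1 : ℕ) : ℤ) < 2 * n := by omega
  have hpos : (0 : ℤ) < n := by omega
  have key : ∀ r : ℤ, |(n : ℤ) * r| ≤ (2 * n - 1 : ℕ) → |r| < 2 := by
    intro r hr
    rw [abs_mul, abs_of_pos hpos] at hr
    nlinarith
  have k1 := abs_lt.1 (key (p + q) (by rwa [mul_add]))
  have k2 := abs_lt.1 (key (2 * p - q) (by
    rwa [show (n : ℤ) * (2 * p - q) = 2 * (n * p) - n * q by ring]))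
  have k3 := abs_lt.1 (key (2 * q - p) (by
    rwa [show (n : ℤ) * (2 * q - p) = 2 * (n * q) - n * p by ring]))
  obtain rfl : p = 0 := by omega
  obtain rfl : q = 0 := by omega
  simp

/-- Both sides vanish on nonconstant exponentials. Continuity is carried through the induction to
supply integrability for additivity. -/
theorem integral_eq_sum_of_mem_trigSpace {n : ℕ} (hn : 1 ≤ n) {g : ℝ × ℝ → ℂ}
    (hg : g ∈ trigSpace (2 * n - 1)) : Continuous g ∧
    ∫ z in Ioc (0 : ℝ) 1 ×ˢ Ioc (0 : ℝ) 1, g z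
      = 1 / (n : ℂ) ^ 2 * ∑ k ∈ Finset.Ico (0 : ℤ) n ×ˢ Finset.Ico (0 : ℤ) n,
        g ((k.1 : ℝ) / (n : ℝ), (k.2 : ℝ) / (n : ℝ)) := by
  have hint : ∀ g : ℝ × ℝ → ℂ, Continuous g → IntegrableOn g (Ioc (0 : ℝ) 1 ×ˢ Ioc (0 : ℝ) 1) :=
    fun g hg => (hg.continuousOn.integrableOn_compact (isCompact_Icc.prod isCompact_Icc)).mono_set
      (prod_mono Ioc_subset_Icc_self Ioc_subset_Icc_self)
  have hn0 : (n : ℂ) ≠ 0 := by exact_mod_cast (by omega : n ≠ 0)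
  induction hg using Submodule.span_induction with
  | mem g hg =>
    obtain ⟨a, b, h1, h2, h3, rfl⟩ := hg
    refine ⟨continuous_expFun a b, ?_⟩
    by_cases hab : (n : ℤ) ∣ a ∧ (n : ℤ) ∣ b
    · obtain ⟨rfl, rfl⟩ := eq_zero_of_dvd_of_hex hn h1 h2 h3 hab.1 hab.2
      rw [expFun_zero]
      simp only [Pi.one_apply, Finset.sum_const, Finset.card_product, Int.card_Ico, sub_zero,
        Int.toNat_natCast, nsmul_eq_mul, mul_one, setIntegral_const]
      rw [Measure.volume_eq_prod, measureReal_prod_prod]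
      simp
      field_simp
    · rw [sum_expFun hn hab, mul_zero]
      apply integral_expFun
      by_contra! h
      exact hab (by simp [h.1, h.2])
  | zero => exact ⟨continuous_zero, by simp⟩
  | add g h _ _ ihg ihh =>
    refine ⟨ihg.1.add ihh.1, ?_⟩
    simp only [Pi.add_apply]
    rw [integral_add (hint g ihg.1) (hint h ihh.1), ihg.2, ihh.2, Finset.sum_add_distrib, mul_add]
  | smul c g _ ih =>
    refine ⟨ih.1.const_smul c, ?_⟩
    simp only [Pi.smul_apply, smul_eq_mul]
    rw [integral_const_mul, ih.2, ← Finset.mul_sum]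
    ring

/-! ### The cubature formula -/

theorem cosMap_eq_coords {j : Fin 3 → ℤ} {k l : ℤ} (n : ℕ) (h0 : j 0 = 2 * k + l)
    (h1 : j 1 = l - k) (h2 : j 2 = -k - 2 * l) :
    cosMap ((k : ℝ) / (n : ℝ), (l : ℝ) / (n : ℝ)) =
      (xCoord fun i => (j i : ℝ) / (n : ℝ), yCoord fun i => (j i : ℝ) / (n : ℝ)) := by
  simp only [cosMap, xCoord, yCoord, h0, h1, h2]
  push_cast
  refine Prod.ext ?_ ?_ <;> dsimp only <;> congr 1
  · congr 1
    · congr 2 <;> ring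
    · rw [← cos_neg]; congr 1; ring
  · congr 1
    · congr 2 <;> ring
    · rw [← cos_neg]; congr 1; ring

theorem integral_fundTriangle_eq_sum {n : ℕ} (hn : 1 ≤ n) {k₁ k₂ : ℕ}
    (hk : 2 * k₁ + 3 * k₂ ≤ 2 * n - 1) :
    12 * ∫ z in fundTriangle, (cosMap z).1 ^ k₁ * (cosMap z).2 ^ k₂ =
      1 / (n : ℝ) ^ 2 * ∑ j ∈ Upsilon n, (omega n j : ℝ) *
        ((xCoord fun i => (j i : ℝ) / (n : ℝ)) ^ k₁ *
          (yCoord fun i => (j i : ℝ) / (n : ℝ)) ^ k₂) := by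
  have hn0 : (n : ℝ) ≠ 0 := by exact_mod_cast (by omega : n ≠ 0)
  set F : ℝ × ℝ → ℝ := fun z => (cosMap z).1 ^ k₁ * (cosMap z).2 ^ k₂ with hF
  have hFc : Continuous F := by have := continuous_cosMap; rw [hF]; fun_prop
  have hcongr : ∀ {z w}, cosMap z = cosMap w → F z = F w := fun h => by simp only [hF, h]
  rw [← integral_unitSquare_eq hFc (fun u v => hcongr (cosMap_swap u v))
    (fun u v => hcongr (cosMap_reflect u v)) (fun u v => hcongr (cosMap_one_sub u v))]
  have hmem : (fun z => ((F z : ℝ) : ℂ)) ∈ trigSpace (2 * n - 1) := by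
    have h := mul_mem_trigSpace (pow_mem_trigSpace cosMap_fst_mem_trigSpace k₁)
      (pow_mem_trigSpace cosMap_snd_mem_trigSpace k₂)
    refine trigSpace_mono hk (?_ : _ ∈ _)
    convert h using 1
    funext z
    simp [hF]
  have hsum := (integral_eq_sum_of_mem_trigSpace hn hmem).2
  rw [integral_complex_ofReal] at hsum
  have hsum' : ∫ z in Ioc (0 : ℝ) 1 ×ˢ Ioc (0 : ℝ) 1, F z
      = 1 / (n : ℝ) ^ 2 * ∑ k ∈ Finset.Ico (0 : ℤ) n ×ˢ Finset.Ico (0 : ℤ) n,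
        F ((k.1 : ℝ) / (n : ℝ), (k.2 : ℝ) / (n : ℝ)) := by
    apply Complex.ofReal_injective
    rw [hsum]
    simp only [Complex.ofReal_mul, Complex.ofReal_div, Complex.ofReal_one, Complex.ofReal_pow,
      Complex.ofReal_natCast, Complex.ofReal_sum]
  rw [hsum', sum_square_eq_sum_Upsilon hn
    (f := fun k l : ℤ => F ((k : ℝ) / (n : ℝ), (l : ℝ) / (n : ℝ)))
    (fun k l => hcongr (cosMap_swap _ _))
    (fun k l => hcongr (by
      rw [← cosMap_reflect]; congr 2; push_cast; field_simp; ring))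
    (fun k l => hcongr (by
      rw [← cosMap_one_sub]; congr 2 <;> push_cast <;> field_simp <;> ring))]
  congr 1
  refine Finset.sum_congr rfl fun j hj => ?_
  rw [mem_Upsilon] at hj
  simp only [hF]
  rw [cosMap_eq_coords (j := j) n (by omega) (by omega) (by omega)]

/-- The case of the constant function; `jacConst` then cancels in the normalized integral. -/
theorem integral_weight : ∫ p in triangleStar, weight (-1 / 2) (-1 / 2) p = jacConst / 12 := by
  have h1 := (integral_triangleStar (g := fun _ => 1) continuous_const).2
  have h2 := integral_unitSquare_eq (F := fun _ => 1) continuous_const (fun _ _ => rfl)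
    (fun _ _ => rfl) (fun _ _ => rfl)
  have h3 : ∫ z in Ioc (0 : ℝ) 1 ×ˢ Ioc (0 : ℝ) 1, (1 : ℝ) = 1 := by
    rw [setIntegral_const, Measure.volume_eq_prod, measureReal_prod_prod]
    simp
  simp only [one_mul] at h1
  rw [h1]
  rw [h3] at h2
  linear_combination (-jacConst / 12) * h2

end GaussLobattoG2

/-! ### From real monomials to all coefficients -/

theorem theorem6p3 {𝕜 : Type*} [RCLike 𝕜] (n : ℕ) (hn : 1 ≤ n)
    (f : MvPolynomial (Fin 2) 𝕜) (hf : f ∈ GaussLobattoG2.PiStar 𝕜 (2 * n - 1)) :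
    IntegrableOn
        (fun p : ℝ × ℝ => GaussLobattoG2.evalAt f p.1 p.2 *
          ((GaussLobattoG2.weight (-1 / 2) (-1 / 2) p : ℝ) : 𝕜))
        GaussLobattoG2.triangleStar ∧
      ((GaussLobattoG2.normConst (-1 / 2) (-1 / 2) : ℝ) : 𝕜) *
          ∫ p in GaussLobattoG2.triangleStar, GaussLobattoG2.evalAt f p.1 p.2 *
            ((GaussLobattoG2.weight (-1 / 2) (-1 / 2) p : ℝ) : 𝕜) =
        1 / (n : 𝕜) ^ 2 *
          ∑ j ∈ GaussLobattoG2.Upsilon n, (GaussLobattoG2.omega n j : 𝕜) *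
            GaussLobattoG2.evalAt f
              (GaussLobattoG2.xCoord fun i => (j i : ℝ) / (n : ℝ))
              (GaussLobattoG2.yCoord fun i => (j i : ℝ) / (n : ℝ)) := by
  -- Integrability belongs to the induction statement because splitting the integral of a sum needs
  -- it.
  induction hf using Submodule.span_induction with
  | mem f hf =>
    obtain ⟨k₁, k₂, hk, rfl⟩ := hf
    have heval : ∀ x y : ℝ, GaussLobattoG2.evalAt
        (MvPolynomial.X 0 ^ k₁ * MvPolynomial.X 1 ^ k₂ : MvPolynomial (Fin 2) 𝕜) x y
        = ((x ^ k₁ * y ^ k₂ : ℝ) : 𝕜) := fun x y => by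
      simp [GaussLobattoG2.evalAt]
    obtain ⟨hint, heq⟩ := GaussLobattoG2.integral_triangleStar
      (g := fun p => p.1 ^ k₁ * p.2 ^ k₂) (by fun_prop)
    simp only [heval, ← RCLike.ofReal_mul]
    refine ⟨hint.ofReal, ?_⟩
    rw [integral_ofReal, heq, GaussLobattoG2.normConst, GaussLobattoG2.integral_weight]
    have hmain := GaussLobattoG2.integral_fundTriangle_eq_sum hn hk
    have hJ := GaussLobattoG2.jacConst_pos.ne'
    rw [← RCLike.ofReal_mul, show ∀ I : ℝ, 1 / (GaussLobattoG2.jacConst / 12) *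
      (GaussLobattoG2.jacConst * I) = 12 * I from fun I => by field_simp, hmain]
    push_cast
    rfl
  | zero => simp [GaussLobattoG2.evalAt]
  | add f g _ _ ihf ihg =>
    have heval : ∀ x y : ℝ, GaussLobattoG2.evalAt (f + g) x y
        = GaussLobattoG2.evalAt f x y + GaussLobattoG2.evalAt g x y := fun x y => map_add _ f g
    simp only [heval, add_mul, mul_add, Finset.sum_add_distrib]
    refine ⟨ihf.1.add ihg.1, ?_⟩
    rw [integral_add ihf.1 ihg.1, mul_add, ihf.2, ihg.2]
  | smul c f _ ih =>
    have heval : ∀ x y : ℝ, GaussLobattoG2.evalAt (c • f) x y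
        = c * GaussLobattoG2.evalAt f x y := fun x y => by
      simp [GaussLobattoG2.evalAt, MvPolynomial.smul_eval]
    simp only [heval, mul_assoc]
    refine ⟨ih.1.const_mul c, ?_⟩
    rw [integral_const_mul, mul_left_comm, ih.2, mul_left_comm c]
    congr 1
    rw [Finset.mul_sum]
    exact Finset.sum_congr rfl fun j _ => mul_left_comm _ _ _
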